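/- For $\varphi,\psi\in L^2(\mathbb R)$ (complex-valued, with $\langle f,g\rangle=\int_{\mathbb R} f\overline g$) let $$\mathrm{Dom}(A)=\Big\{f\in L^2(\mathbb R):\ xf\in L^2(\mathbb R),\ \lim_{R\to\infty}\int_{-R}^R f(x)\,dx \text{ exists and is } 0\Big\},\qquad (Af)(x)=xf(x)+\langle f,\varphi\rangle\psi(x),$$ and let $\widetilde A$ be the operator with the same domain and the roles of $\varphi$ and $\psi$ exchanged. The adjoint $\widetilde A^*$ has domain $\{u\in L^2(\mathbb R):\ \exists c_u\in\mathbb C,\ xu-c_u\in L^2(\mathbb R)\}$, with $c_u$ unique, and acts by $\widetilde A^*u=xu-c_u+\langle u,\varphi\rangle\psi$. On this domain put $\Gamma_1u=\lim_{R\to\infty}\int_{-R}^R u(x)\,dx$ and $\Gamma_2u=c_u$. For $B\in\mathbb C$ let $A_B$ be the restriction of $\widetilde A^*$ to $\ker(\Gamma_1-B\Gamma_2)$, with resolvent set $\rho(A_B)$. For $\lambda\in\rho(A_B)$ and $h\in\mathbb C$ let $S_{\lambda,B}h$ be the unique $u\in\ker(\widetilde A^*-\lambda)$ with $(\Gamma_1-B\Gamma_2)u=h$;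 the Titchmarsh–Weyl function is $M_B(\lambda)h=\Gamma_2S_{\lambda,B}h$, that is, $M_B(\lambda)(\Gamma_1-B\Gamma_2)u=\Gamma_2u$ for all $u\in\ker(\widetilde A^*-\lambda)$. For fixed $\mu_0\in\rho(A_B)$, the detectable subspace $\overline{\mathcal S}$ is the closed linear span of the ranges of $(A_B-\delta)^{-1}S_{\mu_0,B}$, $\delta\in\rho(A_B)$. **Theorem.** The restricted resolvents $(A_B-\lambda)^{-1}|_{\overline{\mathcal S}}$, $\lambda\in\rho(A_B)\setminus\mathbb R$, determine the Titchmarsh–Weyl function $M_B$. Precisely: let $\varphi_j,\psi_j\in L^2(\mathbb R)$ and $B_j\in\mathbb C$ ($j=1,2$) be the parameters of two such models, with operators $A^{(j)}_{B_j}$ and Titchmarsh–Weyl functions $M^{(j)}_{B_j}$, let $\mu_0\in\rho(A^{(1)}_{B_1})$, and let $\overline{\mathcal S}$ be the detectable subspace of the first model. Suppose that $\rho(A^{(1)}_{B_1})\setminus\mathbb R=\rho(A^{(2)}_{B_2})\setminus\mathbb R$ and that $$(A^{(1)}_{B_1}-\lambda)^{-1}g=(A^{(2)}_{B_2}-\lambda)^{-1}g\qquad\text{for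 all }\lambda\in\rho(A^{(1)}_{B_1})\setminus\mathbb R,\ g\in\overline{\mathcal S}.$$ Then every $\lambda\in\rho(A^{(1)}_{B_1})$ lies in $\rho(A^{(2)}_{B_2})$ and satisfies $M^{(1)}_{B_1}(\lambda)=M^{(2)}_{B_2}(\lambda)$. -/

import Mathlib

open MeasureTheory Filter Topology
open scoped ComplexConjugate LinearPMap

noncomputable section

namespace Friedrichs

/-! ### Resolvents of (possibly unbounded) operators -/

/-- `R` is a bounded, everywhere defined, two-sided inverse of `T - z`. -/
def IsResolventAt {H : Type*} [NormedAddCommGroup H] [NormedSpace ℂ H]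
    (T : H →ₗ.[ℂ] H) (z : ℂ) (R : H →L[ℂ] H) : Prop :=
  (∀ g : H, ∃ h : R g ∈ T.domain, T ⟨R g, h⟩ - z • R g = g) ∧
    ∀ f : T.domain, R (T f - z • (f : H)) = f

/-- The resolvent set `ρ(T)`. -/
def resolventSet {H : Type*} [NormedAddCommGroup H] [NormedSpace ℂ H]
    (T : H →ₗ.[ℂ] H) : Set ℂ :=
  {z | ∃ R : H →L[ℂ] H, IsResolventAt T z R}

open Classical in
/-- The resolvent `(T - z)⁻¹` for `z ∈ ρ(T)`, with the value `0` elsewhere. -/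
def resolventOp {H : Type*} [NormedAddCommGroup H] [NormedSpace ℂ H]
    (T : H →ₗ.[ℂ] H) (z : ℂ) : H →L[ℂ] H :=
  if h : ∃ R : H →L[ℂ] H, IsResolventAt T z R then h.choose else 0

theorem resolventOp_spec {H : Type*} [NormedAddCommGroup H] [NormedSpace ℂ H]
    {T : H →ₗ.[ℂ] H} {z : ℂ} (hz : z ∈ resolventSet T) :
    IsResolventAt T z (resolventOp T z) := by
  have hz' : ∃ R : H →L[ℂ] H, IsResolventAt T z R := hz
  rw [resolventOp, dif_pos hz']
  exact hz'.choose_spec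

theorem resolventOp_eq {H : Type*} [NormedAddCommGroup H] [NormedSpace ℂ H]
    {T : H →ₗ.[ℂ] H} {z : ℂ} {R : H →L[ℂ] H} (hR : IsResolventAt T z R) :
    resolventOp T z = R := by
  ext g
  obtain ⟨h, hg⟩ := (resolventOp_spec (T := T) ⟨R, hR⟩).1 g
  have := hR.2 ⟨_, h⟩
  simp only at this
  rw [hg] at this
  exact this.symm

/-! ### The Friedrichs model operator on `L²(ℝ)` -/

/-- The Hilbert space `L²(ℝ)` of complex valued functions. -/
abbrev L2R : Type := Lp ℂ 2 (volume : Measure ℝ)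

theorem intervalIntegrable_coe (f : L2R) (a b : ℝ) :
    IntervalIntegrable (fun x => f x) volume a b :=
  ((Lp.memLp f).locallyIntegrable (by norm_num)).integrableOn_isCompact isCompact_uIcc
    |>.intervalIntegrable

theorem intervalIntegral_coe_add (f g : L2R) (a b : ℝ) :
    ∫ x in a..b, (f + g : L2R) x = (∫ x in a..b, f x) + ∫ x in a..b, g x := by
  rw [← intervalIntegral.integral_add (intervalIntegrable_coe f a b)
    (intervalIntegrable_coe g a b)]
  refine intervalIntegral.integral_congr_ae ?_
  filter_upwards [Lp.coeFn_add f g] with x hx _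
  simpa using hx

theorem intervalIntegral_coe_smul (c : ℂ) (f : L2R) (a b : ℝ) :
    ∫ x in a..b, (c • f : L2R) x = c * ∫ x in a..b, f x := by
  rw [← intervalIntegral.integral_const_mul]
  refine intervalIntegral.integral_congr_ae ?_
  filter_upwards [Lp.coeFn_smul c f] with x hx _
  simpa using hx

theorem intervalIntegral_coe_zero (a b : ℝ) : ∫ x in a..b, (0 : L2R) x = 0 := by
  rw [← zero_smul ℂ (0 : L2R), intervalIntegral_coe_smul, zero_mul]

theorem memLp_mul_add {f g : L2R} {c d : ℂ}
    (hf : MemLp (fun x : ℝ => (x : ℂ) * f x - c) 2 volume)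
    (hg : MemLp (fun x : ℝ => (x : ℂ) * g x - d) 2 volume) :
    MemLp (fun x : ℝ => (x : ℂ) * (f + g : L2R) x - (c + d)) 2 volume := by
  refine (memLp_congr_ae ?_).mpr (hf.add hg)
  filter_upwards [Lp.coeFn_add f g] with x hx
  simp only [Pi.add_apply] at hx ⊢
  rw [hx]; ring

theorem memLp_mul_smul {f : L2R} {c : ℂ} (a : ℂ)
    (hf : MemLp (fun x : ℝ => (x : ℂ) * f x - c) 2 volume) :
    MemLp (fun x : ℝ => (x : ℂ) * (a • f : L2R) x - a * c) 2 volume := by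
  refine (memLp_congr_ae ?_).mpr (hf.const_smul a)
  filter_upwards [Lp.coeFn_smul a f] with x hx
  simp only [Pi.smul_apply, smul_eq_mul] at hx ⊢
  rw [hx]; ring

/-- The domain `{f ∈ L² | x f ∈ L², lim_{R → ∞} ∫_{-R}^R f = 0}` of the Friedrichs operators. -/
def minDomain : Submodule ℂ L2R where
  carrier := {f | MemLp (fun x : ℝ => (x : ℂ) * f x) 2 volume ∧
    Tendsto (fun R : ℝ => ∫ x in (-R)..R, f x) atTop (𝓝 0)}
  zero_mem' := by
    refine ⟨?_, ?_⟩
    · refine (memLp_congr_ae ?_).mpr (MemLp.zero (ε := ℂ))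
      filter_upwards [Lp.coeFn_zero ℂ 2 (volume : Measure ℝ)] with x hx
      rw [hx]; simp
    · simp only [intervalIntegral_coe_zero]
      exact tendsto_const_nhds
  add_mem' := by
    rintro f g ⟨hf, hf'⟩ ⟨hg, hg'⟩
    refine ⟨?_, ?_⟩
    · simpa using memLp_mul_add (f := f) (g := g) (c := 0) (d := 0)
        (by simpa using hf) (by simpa using hg)
    · simp only [intervalIntegral_coe_add]
      simpa using hf'.add hg'
  smul_mem' := by
    rintro a f ⟨hf, hf'⟩
    refine ⟨?_, ?_⟩
    · simpa using memLp_mul_smul (f := f) (c := 0) a (by simpa using hf)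
    · simp only [intervalIntegral_coe_smul]
      simpa using hf'.const_mul a

/-- The Friedrichs operator `(A f)(x) = x f(x) + ⟨f, φ⟩ ψ(x)` on `minDomain`, where
`⟨f, φ⟩ = ∫ f(x) conj(φ(x)) dx`. -/
def friedrichs (φ ψ : L2R) : L2R →ₗ.[ℂ] L2R where
  domain := minDomain
  toFun :=
    { toFun := fun f => f.2.1.toLp (fun x : ℝ => (x : ℂ) * (f : L2R) x) + inner ℂ φ (f : L2R) • ψ
      map_add' := by
        intro f g
        have : (f + g).2.1.toLp (fun x : ℝ => (x : ℂ) * ((f + g : minDomain) : L2R) x) =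
            f.2.1.toLp (fun x : ℝ => (x : ℂ) * (f : L2R) x) +
              g.2.1.toLp (fun x : ℝ => (x : ℂ) * (g : L2R) x) := by
          rw [← MemLp.toLp_add, MemLp.toLp_eq_toLp_iff]
          filter_upwards [Lp.coeFn_add (f : L2R) (g : L2R)] with x hx
          simp only [Submodule.coe_add, Pi.add_apply] at hx ⊢
          rw [hx]; ring
        rw [this, Submodule.coe_add, inner_add_right, add_smul]
        abel
      map_smul' := by
        intro a f
        have : (a • f).2.1.toLp (fun x : ℝ => (x : ℂ) * ((a • f : minDomain) : L2R) x) =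
            a • f.2.1.toLp (fun x : ℝ => (x : ℂ) * (f : L2R) x) := by
          rw [← MemLp.toLp_const_smul, MemLp.toLp_eq_toLp_iff]
          filter_upwards [Lp.coeFn_smul a (f : L2R)] with x hx
          simp only [Submodule.coe_smul, Pi.smul_apply, smul_eq_mul] at hx ⊢
          rw [hx]; ring
        rw [this, Submodule.coe_smul, inner_smul_right, RingHom.id_apply, smul_add, mul_smul] }

/-- The operator `Ã f = x f + ⟨f, ψ⟩ φ`, in which the roles of `φ` and `ψ` are exchanged. -/
def friedrichsTilde (φ ψ : L2R) : L2R →ₗ.[ℂ] L2R := friedrichs ψ φ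

/-- The Hilbert space adjoint `Ã*`. -/
def maxOp (φ ψ : L2R) : L2R →ₗ.[ℂ] L2R := (friedrichsTilde φ ψ)†

/-! ### The boundary triple -/

/-- The set `{f ∈ L² | ∃ c, x f - c ∈ L²}`; by `mem_maxOp_domain` it is the domain of `Ã*`. -/
def maxDomain : Submodule ℂ L2R where
  carrier := {f | ∃ c : ℂ, MemLp (fun x : ℝ => (x : ℂ) * f x - c) 2 volume}
  zero_mem' := ⟨0, by simp⟩
  add_mem' := by
    rintro f g ⟨c, hc⟩ ⟨d, hd⟩
    exact ⟨_, memLp_mul_add hc hd⟩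
  smul_mem' := by
    rintro a f ⟨c, hc⟩
    exact ⟨_, memLp_mul_smul a hc⟩

/-- The trace `Γ₁ u = lim_{R → ∞} ∫_{-R}^R u(x) dx`. -/
def Gamma1 (u : L2R) : ℂ := limUnder atTop (fun R : ℝ => ∫ x in (-R)..R, u x)

open Classical in
/-- The trace `Γ₂ u = c_u`, the unique constant with `x u - c_u ∈ L²`. -/
def Gamma2 (u : L2R) : ℂ :=
  if h : ∃ c : ℂ, MemLp (fun x : ℝ => (x : ℂ) * u x - c) 2 volume then h.choose else 0

theorem const_unique {f : L2R} {c d : ℂ}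
    (hc : MemLp (fun x : ℝ => (x : ℂ) * f x - c) 2 volume)
    (hd : MemLp (fun x : ℝ => (x : ℂ) * f x - d) 2 volume) : c = d := by
  have h := hd.sub hc
  have h' : MemLp (fun _ : ℝ => c - d) 2 volume := by
    refine (memLp_congr_ae (Eventually.of_forall fun x => ?_)).mp h
    simp
  rw [memLp_const_iff (by norm_num) (by norm_num)] at h'
  simpa [sub_eq_zero] using h'

theorem Gamma2_eq {f : L2R} {c : ℂ}
    (hc : MemLp (fun x : ℝ => (x : ℂ) * f x - c) 2 volume) : Gamma2 f = c := by
  have h : ∃ c : ℂ, MemLp (fun x : ℝ => (x : ℂ) * f x - c) 2 volume := ⟨c, hc⟩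
  rw [Gamma2, dif_pos h]
  exact const_unique h.choose_spec hc

theorem Gamma2_spec {f : L2R} (hf : f ∈ maxDomain) :
    MemLp (fun x : ℝ => (x : ℂ) * f x - Gamma2 f) 2 volume := by
  obtain ⟨c, hc⟩ := hf
  rwa [Gamma2_eq hc]

theorem ofReal_add_I_ne_zero (x : ℝ) : (x : ℂ) + Complex.I ≠ 0 := by
  intro h
  have := congrArg Complex.im h
  simp at this

theorem memLp_inv_add_I : MemLp (fun x : ℝ => ((x : ℂ) + Complex.I)⁻¹) 2 volume := by
  have hcont : Continuous (fun x : ℝ => ((x : ℂ) + Complex.I)⁻¹) :=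
    (Complex.continuous_ofReal.add continuous_const).inv₀ ofReal_add_I_ne_zero
  rw [memLp_two_iff_integrable_sq_norm hcont.aestronglyMeasurable]
  refine integrable_inv_one_add_sq.congr (Eventually.of_forall fun x => ?_)
  simp only [norm_inv, inv_pow]
  congr 1
  rw [← Complex.normSq_eq_norm_sq, Complex.normSq_apply]
  simp
  ring

theorem exists_tendsto_integral_inv_add_I :
    ∃ l : ℂ, Tendsto (fun R : ℝ => ∫ x in (-R)..R, ((x : ℂ) + Complex.I)⁻¹) atTop (𝓝 l) := by
  have hcont : Continuous (fun x : ℝ => ((x : ℂ) + Complex.I)⁻¹) :=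
    (Complex.continuous_ofReal.add continuous_const).inv₀ ofReal_add_I_ne_zero
  have hint : Integrable (fun x : ℝ => (((1 + x ^ 2)⁻¹ : ℝ) : ℂ) * (-Complex.I)) :=
    (integrable_inv_one_add_sq.ofReal).mul_const _
  refine ⟨_, (intervalIntegral_tendsto_integral hint tendsto_neg_atTop_atBot tendsto_id).congr
    fun R => ?_⟩
  have h1 : ∫ x in (-R)..R, (((-x : ℝ) : ℂ) + Complex.I)⁻¹ =
      ∫ x in (-R)..R, ((x : ℂ) + Complex.I)⁻¹ := by
    have := intervalIntegral.integral_comp_neg (a := -R) (b := R)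
      (fun x : ℝ => ((x : ℂ) + Complex.I)⁻¹)
    simpa using this
  have h2 : (∫ x in (-R)..R, ((x : ℂ) + Complex.I)⁻¹) +
      ∫ x in (-R)..R, (((-x : ℝ) : ℂ) + Complex.I)⁻¹ =
      2 * ∫ x in (-R)..R, (((1 + x ^ 2)⁻¹ : ℝ) : ℂ) * (-Complex.I) := by
    have hcont' : Continuous (fun x : ℝ => (((-x : ℝ) : ℂ) + Complex.I)⁻¹) :=
      hcont.comp continuous_neg
    rw [← intervalIntegral.integral_add (hcont.intervalIntegrable _ _)
      (hcont'.intervalIntegrable _ _), ← intervalIntegral.integral_const_mul]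
    refine intervalIntegral.integral_congr fun x _ => ?_
    have e1 := ofReal_add_I_ne_zero x
    have e2 := ofReal_add_I_ne_zero (-x)
    have e3 : (1 + (x : ℂ) ^ 2) ≠ 0 := by
      have : (1 + (x : ℂ) ^ 2) = -(((x : ℂ) + Complex.I) * (((-x : ℝ) : ℂ) + Complex.I)) := by
        push_cast
        linear_combination Complex.I_sq
      rw [this]
      exact neg_ne_zero.mpr (mul_ne_zero e1 e2)
    push_cast at e2 ⊢
    field_simp
    linear_combination (2 * Complex.I) * Complex.I_sq
  rw [h1] at h2
  have h3 := mul_left_cancel₀ two_ne_zero ((two_mul _).trans h2)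
  exact h3.symm

/-- The limit in the definition of `Γ₁` exists on the domain of `Ã*`. -/
theorem tendsto_Gamma1 {f : L2R} (hf : f ∈ maxDomain) :
    Tendsto (fun R : ℝ => ∫ x in (-R)..R, f x) atTop (𝓝 (Gamma1 f)) := by
  refine tendsto_nhds_limUnder ?_
  obtain ⟨c, hc⟩ := hf
  obtain ⟨l, hl⟩ := exists_tendsto_integral_inv_add_I
  have hv := hc.add ((Lp.memLp f).const_smul Complex.I)
  have hint := memLp_inv_add_I.integrable_mul hv
  have hcont : Continuous (fun x : ℝ => ((x : ℂ) + Complex.I)⁻¹) :=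
    (Complex.continuous_ofReal.add continuous_const).inv₀ ofReal_add_I_ne_zero
  refine ⟨_, ((hl.const_mul c).add (intervalIntegral_tendsto_integral hint
    tendsto_neg_atTop_atBot tendsto_id)).congr fun R => ?_⟩
  rw [← intervalIntegral.integral_const_mul, id, ← intervalIntegral.integral_add
    ((hcont.intervalIntegrable _ _).const_mul c) hint.intervalIntegrable]
  refine intervalIntegral.integral_congr fun x _ => ?_
  have e1 := ofReal_add_I_ne_zero x
  simp only [Pi.mul_apply, Pi.add_apply, Pi.smul_apply, smul_eq_mul]
  field_simp
  ring

theorem Gamma1_eq {f : L2R} {l : ℂ}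
    (h : Tendsto (fun R : ℝ => ∫ x in (-R)..R, f x) atTop (𝓝 l)) : Gamma1 f = l :=
  h.limUnder_eq

theorem Gamma1_add {f g : L2R} (hf : f ∈ maxDomain) (hg : g ∈ maxDomain) :
    Gamma1 (f + g) = Gamma1 f + Gamma1 g := by
  refine Gamma1_eq ?_
  simp only [intervalIntegral_coe_add]
  exact (tendsto_Gamma1 hf).add (tendsto_Gamma1 hg)

theorem Gamma1_smul (a : ℂ) {f : L2R} (hf : f ∈ maxDomain) :
    Gamma1 (a • f) = a * Gamma1 f := by
  refine Gamma1_eq ?_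
  simp only [intervalIntegral_coe_smul]
  exact (tendsto_Gamma1 hf).const_mul a

theorem Gamma2_add {f g : L2R} (hf : f ∈ maxDomain) (hg : g ∈ maxDomain) :
    Gamma2 (f + g) = Gamma2 f + Gamma2 g :=
  Gamma2_eq (memLp_mul_add (Gamma2_spec hf) (Gamma2_spec hg))

theorem Gamma2_smul (a : ℂ) {f : L2R} (hf : f ∈ maxDomain) :
    Gamma2 (a • f) = a * Gamma2 f :=
  Gamma2_eq (memLp_mul_smul a (Gamma2_spec hf))

/-! ### The adjoint `Ã*` and the traces -/

theorem integrable_of_mem_minDomain {u : L2R} (hu : u ∈ minDomain) :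
    Integrable (fun x => u x) volume := by
  have hv := hu.1.add ((Lp.memLp u).const_smul Complex.I)
  refine (memLp_inv_add_I.integrable_mul hv).congr (Eventually.of_forall fun x => ?_)
  have e1 := ofReal_add_I_ne_zero x
  simp only [Pi.mul_apply, Pi.add_apply, Pi.smul_apply, smul_eq_mul]
  field_simp

theorem integral_eq_zero_of_mem_minDomain {u : L2R} (hu : u ∈ minDomain) :
    ∫ x, u x = 0 :=
  tendsto_nhds_unique (intervalIntegral_tendsto_integral (integrable_of_mem_minDomain hu)
    tendsto_neg_atTop_atBot tendsto_id) hu.2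

theorem exists_const_of_orthogonal {h : ℝ → ℂ} (hloc : LocallyIntegrable h volume)
    (H : ∀ u ∈ minDomain, ∫ x, u x * h x = 0) : ∃ c : ℂ, h =ᵐ[volume] fun _ => c := by
  have hI : IntegrableOn h (Set.Icc 0 1) volume := hloc.integrableOn_isCompact isCompact_Icc
  refine ⟨∫ x in Set.Icc (0 : ℝ) 1, h x, ?_⟩
  refine ae_eq_of_integral_contDiff_smul_eq hloc (locallyIntegrable_const _) fun g hg hgs => ?_
  set k : ℂ := ∫ x, ((g x : ℝ) : ℂ) with hk
  set one : ℝ → ℂ := Set.indicator (Set.Icc 0 1) (fun _ => (1 : ℂ)) with hone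
  have hgc : Continuous (fun x : ℝ => (g x : ℂ)) := Complex.continuous_ofReal.comp hg.continuous
  have hgs' : HasCompactSupport (fun x : ℝ => (g x : ℂ)) := hgs.comp_left Complex.ofReal_zero
  have honeL (p : ENNReal) : MemLp one p volume :=
    memLp_indicator_const p measurableSet_Icc 1 (Or.inr (by simp))
  have hu : MemLp (fun x => (g x : ℂ) - k * one x) 2 volume :=
    (hgc.memLp_of_hasCompactSupport hgs').sub ((honeL 2).const_mul k)
  have hgi : Integrable (fun x : ℝ => (g x : ℂ)) := hgc.integrable_of_hasCompactSupport hgs'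
  have honei : Integrable one := memLp_one_iff_integrable.mp (honeL 1)
  have hui : Integrable (fun x => (g x : ℂ) - k * one x) := hgi.sub (honei.const_mul k)
  have hcoe := hu.coeFn_toLp
  have hmem : hu.toLp _ ∈ minDomain := by
    constructor
    · have h1 : MemLp (fun x : ℝ => (x : ℂ) * (g x : ℂ)) 2 volume :=
        (Complex.continuous_ofReal.mul hgc).memLp_of_hasCompactSupport hgs'.mul_left
      have h2 : MemLp (fun x : ℝ => (x : ℂ) * one x) 2 volume := by
        refine (honeL 2).mono (Complex.continuous_ofReal.aestronglyMeasurable.mul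
          (honeL 2).aestronglyMeasurable) (Eventually.of_forall fun x => ?_)
        by_cases hx : x ∈ Set.Icc (0 : ℝ) 1
        · simp only [hone, Set.indicator_of_mem hx, mul_one, Complex.norm_real, norm_one]
          rw [Real.norm_eq_abs, abs_of_nonneg hx.1]
          exact hx.2
        · simp [hone, Set.indicator_of_notMem hx]
      refine (memLp_congr_ae ?_).mpr (h1.sub (h2.const_mul k))
      filter_upwards [hcoe] with x hx
      simp only [Pi.sub_apply, hx]
      ring
    · have h1 := intervalIntegral_tendsto_integral hui tendsto_neg_atTop_atBot tendsto_id
      have h2 : ∫ x, ((g x : ℂ) - k * one x) = 0 := by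
        rw [integral_sub hgi (honei.const_mul k), integral_const_mul, hone,
          integral_indicator measurableSet_Icc]
        simp [hk]
      rw [h2] at h1
      refine h1.congr fun R => intervalIntegral.integral_congr_ae ?_
      filter_upwards [hcoe] with x hx _ using hx.symm
  have hgh : Integrable (fun x => (g x : ℂ) * h x) := by
    simpa using hloc.integrable_smul_left_of_hasCompactSupport hgc hgs'
  have honeh : Integrable (fun x => one x * h x) := by
    refine (hI.integrable_indicator measurableSet_Icc).congr (Eventually.of_forall fun x => ?_)
    by_cases hx : x ∈ Set.Icc (0 : ℝ) 1
    · simp [hone, Set.indicator_of_mem hx]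
    · simp [hone, Set.indicator_of_notMem hx]
  have honeh' : ∫ x, one x * h x = ∫ x in Set.Icc (0 : ℝ) 1, h x := by
    rw [← integral_indicator measurableSet_Icc]
    refine integral_congr_ae (Eventually.of_forall fun x => ?_)
    by_cases hx : x ∈ Set.Icc (0 : ℝ) 1
    · simp [hone, Set.indicator_of_mem hx]
    · simp [hone, Set.indicator_of_notMem hx]
  have key := H _ hmem
  have e : ∫ x, (hu.toLp _ : L2R) x * h x = ∫ x, ((g x : ℂ) * h x - k * (one x * h x)) := by
    refine integral_congr_ae ?_
    filter_upwards [hcoe] with x hx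
    rw [hx]; ring
  rw [e, integral_sub hgh (honeh.const_mul k), integral_const_mul, honeh', sub_eq_zero] at key
  simp only [Complex.real_smul]
  rw [key, integral_mul_const]

theorem locallyIntegrable_coe (f : L2R) : LocallyIntegrable (fun x => f x) volume :=
  (Lp.memLp f).locallyIntegrable (by norm_num)

theorem inner_eq_integral (f g : L2R) : inner ℂ f g = ∫ x, conj (f x) * g x := by
  rw [L2.inner_def]
  refine integral_congr_ae (Eventually.of_forall fun x => ?_)
  simp [mul_comm]

theorem locallyIntegrable_conj {f : ℝ → ℂ} (hf : LocallyIntegrable f volume) :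
    LocallyIntegrable (fun x => conj (f x)) volume := fun x => by
  obtain ⟨s, hs, hi⟩ := hf x
  exact ⟨s, hs, (Complex.conjCLE.toContinuousLinearMap.integrable_comp hi : )⟩

/-- `minDomain` is dense, so that adjoints of the Friedrichs operators are meaningful. -/
theorem dense_minDomain : Dense (minDomain : Set L2R) := by
  rw [Submodule.dense_iff_topologicalClosure_eq_top, Submodule.topologicalClosure_eq_top_iff,
    Submodule.eq_bot_iff]
  intro v hv
  obtain ⟨c, hc⟩ := exists_const_of_orthogonal (locallyIntegrable_conj (locallyIntegrable_coe v))
    (fun u hu => by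
      have := Submodule.inner_left_of_mem_orthogonal hu hv
      rw [inner_eq_integral] at this
      simpa [mul_comm] using this)
  have hc' : (fun x => v x) =ᵐ[volume] fun _ => conj c := by
    filter_upwards [hc] with x hx
    rw [← hx, Complex.conj_conj]
  have hm : MemLp (fun _ : ℝ => conj c) 2 volume := (memLp_congr_ae hc').mp (Lp.memLp v)
  rw [memLp_const_iff (by norm_num) (by norm_num)] at hm
  have hz : conj c = 0 := by simpa using hm
  rw [Lp.eq_zero_iff_ae_eq_zero]
  filter_upwards [hc'] with x hx
  rw [hx, hz]; rfl

theorem friedrichs_inner (φ ψ v : L2R) (u : (friedrichs φ ψ).domain) :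
    inner ℂ v (friedrichs φ ψ u) =
      (∫ x : ℝ, conj (v x) * ((x : ℂ) * (u : L2R) x)) + inner ℂ (inner ℂ ψ v • φ) (u : L2R) := by
  have : friedrichs φ ψ u = u.2.1.toLp (fun x : ℝ => (x : ℂ) * (u : L2R) x) +
    inner ℂ φ (u : L2R) • ψ := rfl
  rw [this, inner_add_right, inner_smul_right, inner_smul_left, inner_conj_symm, inner_eq_integral,
    mul_comm (inner ℂ φ (u : L2R))]
  congr 1
  refine integral_congr_ae ?_
  filter_upwards [u.2.1.coeFn_toLp] with x hx
  rw [hx]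

theorem inner_toLp_of_mem (v u : L2R) {c : ℂ}
    (hc : MemLp (fun x : ℝ => (x : ℂ) * v x - c) 2 volume) (hu : u ∈ minDomain) :
    inner ℂ (hc.toLp _) u = ∫ x : ℝ, conj (v x) * ((x : ℂ) * u x) := by
  have h1 : Integrable (fun x : ℝ => conj (v x) * ((x : ℂ) * u x)) := by
    have := (Lp.memLp v).star.integrable_mul hu.1
    exact this
  rw [inner_eq_integral]
  have h2 : ∫ x : ℝ, conj ((hc.toLp _ : L2R) x) * u x =
      ∫ x : ℝ, (conj (v x) * ((x : ℂ) * u x) - conj c * u x) := by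
    refine integral_congr_ae ?_
    filter_upwards [hc.coeFn_toLp] with x hx
    rw [hx]
    simp only [map_sub, map_mul, Complex.conj_ofReal]
    ring
  rw [h2, integral_sub h1 ((integrable_of_mem_minDomain hu).const_mul _), integral_const_mul,
    integral_eq_zero_of_mem_minDomain hu]
  simp

theorem maxOp_aux (φ ψ v : L2R) {c : ℂ}
    (hc : MemLp (fun x : ℝ => (x : ℂ) * v x - c) 2 volume)
    (u : (friedrichsTilde φ ψ).domain) :
    inner ℂ (hc.toLp _ + inner ℂ φ v • ψ) (u : L2R) = inner ℂ v (friedrichsTilde φ ψ u) := by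
  rw [inner_add_left, inner_toLp_of_mem v u hc u.2]
  exact (friedrichs_inner ψ φ v u).symm

/-- The domain of `Ã*`. -/
theorem mem_maxOp_domain (φ ψ v : L2R) : v ∈ (maxOp φ ψ).domain ↔ v ∈ maxDomain := by
  constructor
  · intro hv
    have hf := LinearPMap.adjoint_isFormalAdjoint
      (T := friedrichsTilde φ ψ) dense_minDomain ⟨v, hv⟩
    set w : L2R := (friedrichsTilde φ ψ)† ⟨v, hv⟩ - inner ℂ φ v • ψ with hw
    have hlv : LocallyIntegrable (fun x : ℝ => (x : ℂ) * conj (v x)) volume := by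
      have := (locallyIntegrable_conj (locallyIntegrable_coe v)).continuous_smul
        Complex.continuous_ofReal
      simpa using this
    obtain ⟨c, hc⟩ := exists_const_of_orthogonal
      (hlv.sub (locallyIntegrable_conj (locallyIntegrable_coe w))) (fun u hu => by
        have h1 := (hf ⟨u, hu⟩).trans (friedrichs_inner ψ φ v ⟨u, hu⟩)
        have h2 : inner ℂ w u = ∫ x : ℝ, conj (v x) * ((x : ℂ) * u x) := by
          rw [hw, inner_sub_left]
          exact sub_eq_of_eq_add h1
        rw [inner_eq_integral] at h2
        have i1 : Integrable (fun x : ℝ => conj (v x) * ((x : ℂ) * u x)) :=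
          (Lp.memLp v).star.integrable_mul hu.1
        have i2 : Integrable (fun x : ℝ => conj (w x) * u x) :=
          (Lp.memLp w).star.integrable_mul (Lp.memLp u)
        have h3 : ∫ x : ℝ, u x * ((x : ℂ) * conj (v x) - conj (w x)) =
            ∫ x : ℝ, (conj (v x) * ((x : ℂ) * u x) - conj (w x) * u x) := by
          congr 1
          ext x
          ring
        simp only [Pi.sub_apply]
        rw [h3, integral_sub i1 i2, h2, sub_self])
    refine ⟨conj c, (memLp_congr_ae ?_).mp (Lp.memLp w)⟩
    filter_upwards [hc] with x hx
    rw [← hx]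
    simp
  · rintro ⟨c, hc⟩
    exact LinearPMap.mem_adjoint_domain_of_exists _ ⟨_, maxOp_aux φ ψ v hc⟩

/-- The formula `Ã* u = x u - c_u + ⟨u, φ⟩ ψ`. -/
theorem maxOp_apply (φ ψ : L2R) (v : (maxOp φ ψ).domain) :
    (maxOp φ ψ v : L2R) =ᵐ[volume]
      fun x : ℝ => (x : ℂ) * (v : L2R) x - Gamma2 v + inner ℂ φ (v : L2R) * ψ x := by
  have hc := Gamma2_spec ((mem_maxOp_domain φ ψ v).mp v.2)
  have h : maxOp φ ψ v = hc.toLp _ + inner ℂ φ (v : L2R) • ψ :=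
    LinearPMap.adjoint_apply_eq dense_minDomain v (maxOp_aux φ ψ v hc)
  rw [h]
  filter_upwards [Lp.coeFn_add (hc.toLp _) (inner ℂ φ (v : L2R) • ψ), hc.coeFn_toLp,
    Lp.coeFn_smul (inner ℂ φ (v : L2R)) ψ] with x h1 h2 h3
  rw [h1, Pi.add_apply, h2, h3]
  rfl

/-- The boundary condition `Γ₁ u = B Γ₂ u`, as a subspace. -/
def boundaryCondition (B : ℂ) : Submodule ℂ L2R where
  carrier := {u | u ∈ maxDomain ∧ Gamma1 u - B * Gamma2 u = 0}
  zero_mem' := by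
    refine ⟨maxDomain.zero_mem, ?_⟩
    have h1 := Gamma1_smul 0 maxDomain.zero_mem
    have h2 := Gamma2_smul 0 maxDomain.zero_mem
    rw [zero_smul] at h1 h2
    rw [h1, h2]; ring
  add_mem' := by
    rintro f g ⟨hf, hf'⟩ ⟨hg, hg'⟩
    refine ⟨maxDomain.add_mem hf hg, ?_⟩
    rw [Gamma1_add hf hg, Gamma2_add hf hg]
    linear_combination hf' + hg'
  smul_mem' := by
    rintro a f ⟨hf, hf'⟩
    refine ⟨maxDomain.smul_mem a hf, ?_⟩
    rw [Gamma1_smul a hf, Gamma2_smul a hf]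
    linear_combination a * hf'

/-- The extension `A_B`, the restriction of `Ã*` to `ker (Γ₁ - B Γ₂)`. -/
def extOp (φ ψ : L2R) (B : ℂ) : L2R →ₗ.[ℂ] L2R := (maxOp φ ψ).domRestrict (boundaryCondition B)

/-! ### Solution operator, `M`-function, detectable subspace -/

/-- `u ∈ ker (Ã* - z)` and `(Γ₁ - B Γ₂) u = h`. -/
def IsSolution (φ ψ : L2R) (B z h : ℂ) (u : L2R) : Prop :=
  (∃ hu : u ∈ (maxOp φ ψ).domain, maxOp φ ψ ⟨u, hu⟩ = z • u) ∧ Gamma1 u - B * Gamma2 u = h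

open Classical in
/-- The solution operator `S_{z,B}`; it is well defined for `z ∈ ρ(A_B)`, see
`existsUnique_isSolution`. -/
def solutionOp (φ ψ : L2R) (B z h : ℂ) : L2R :=
  if hex : ∃ u : L2R, IsSolution φ ψ B z h u then hex.choose else 0

/-- The Titchmarsh-Weyl function `M_B(z) : ℂ → ℂ`, which maps `(Γ₁ - B Γ₂) u` to `Γ₂ u` for
`u ∈ ker (Ã* - z)`, see `mFunction_apply`. -/
def mFunction (φ ψ : L2R) (B z : ℂ) : ℂ → ℂ := fun h => Gamma2 (solutionOp φ ψ B z h)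

/-- `Γ₁ - B Γ₂` maps the domain of `Ã*` onto `ℂ`. -/
theorem exists_trace_eq (B h : ℂ) : ∃ u ∈ maxDomain, Gamma1 u - B * Gamma2 u = h := by
  set one : ℝ → ℂ := Set.indicator (Set.Icc 0 1) (fun _ => (1 : ℂ)) with hone
  have honeL (p : ENNReal) : MemLp one p volume :=
    memLp_indicator_const p measurableSet_Icc 1 (Or.inr (by simp))
  have hx1 : MemLp (fun x : ℝ => (x : ℂ) * ((honeL 2).toLp one : L2R) x - 0) 2 volume := by
    refine (honeL 2).mono ((Complex.continuous_ofReal.aestronglyMeasurable.mul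
      (Lp.aestronglyMeasurable _)).sub aestronglyMeasurable_const) ?_
    filter_upwards [(honeL 2).coeFn_toLp] with x hxx
    rw [hxx]
    by_cases hx : x ∈ Set.Icc (0 : ℝ) 1
    · simp only [hone, Set.indicator_of_mem hx, mul_one, sub_zero, Complex.norm_real, norm_one]
      rw [Real.norm_eq_abs, abs_of_nonneg hx.1]
      exact hx.2
    · simp [hone, Set.indicator_of_notMem hx]
  have hmem : (honeL 2).toLp one ∈ maxDomain := ⟨0, hx1⟩
  have h1 : Gamma1 ((honeL 2).toLp one) = 1 := by
    refine Gamma1_eq ?_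
    have hi := intervalIntegral_tendsto_integral (memLp_one_iff_integrable.mp (honeL 1))
      tendsto_neg_atTop_atBot tendsto_id
    have h2 : ∫ x, one x = 1 := by
      rw [hone, integral_indicator measurableSet_Icc]
      simp
    rw [h2] at hi
    refine hi.congr fun R => intervalIntegral.integral_congr_ae ?_
    filter_upwards [(honeL 2).coeFn_toLp] with x hx _ using hx.symm
  refine ⟨h • (honeL 2).toLp one, maxDomain.smul_mem h hmem, ?_⟩
  rw [Gamma1_smul h hmem, Gamma2_smul h hmem, h1, Gamma2_eq hx1]
  ring

/-- For `z ∈ ρ(A_B)` the solution operator is defined everywhere and single valued. -/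
theorem existsUnique_isSolution {φ ψ : L2R} {B z : ℂ} (hz : z ∈ resolventSet (extOp φ ψ B))
    (h : ℂ) : ∃! u : L2R, IsSolution φ ψ B z h u := by
  obtain ⟨R, hR1, hR2⟩ := hz
  have comb (a : ℂ) {u v : L2R} (hu : u ∈ (maxOp φ ψ).domain) (hv : v ∈ (maxOp φ ψ).domain) :
      ∃ hw : u + a • v ∈ (maxOp φ ψ).domain,
        maxOp φ ψ ⟨u + a • v, hw⟩ = maxOp φ ψ ⟨u, hu⟩ + a • maxOp φ ψ ⟨v, hv⟩ ∧
        Gamma1 (u + a • v) - B * Gamma2 (u + a • v) =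
          (Gamma1 u - B * Gamma2 u) + a * (Gamma1 v - B * Gamma2 v) := by
    have hu' := (mem_maxOp_domain φ ψ u).mp hu
    have hv' := (mem_maxOp_domain φ ψ v).mp hv
    refine ⟨(maxOp φ ψ).domain.add_mem hu ((maxOp φ ψ).domain.smul_mem a hv), ?_, ?_⟩
    · rw [← LinearPMap.map_smul, ← LinearPMap.map_add]
      rfl
    · rw [Gamma1_add hu' (maxDomain.smul_mem a hv'), Gamma2_add hu' (maxDomain.smul_mem a hv'),
        Gamma1_smul a hv', Gamma2_smul a hv']
      ring
  obtain ⟨u₀, hu₀, hu₀h⟩ := exists_trace_eq B h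
  have hu₀' := (mem_maxOp_domain φ ψ u₀).mpr hu₀
  obtain ⟨hr, hRg⟩ := hR1 (maxOp φ ψ ⟨u₀, hu₀'⟩ - z • u₀)
  set r : L2R := R (maxOp φ ψ ⟨u₀, hu₀'⟩ - z • u₀) with hrdef
  have hrd : r ∈ (maxOp φ ψ).domain := hr.2
  have hre : extOp φ ψ B ⟨r, hr⟩ = maxOp φ ψ ⟨r, hrd⟩ := LinearPMap.domRestrict_apply rfl
  obtain ⟨hw, hw1, hw2⟩ := comb (-1) hu₀' hrd
  refine ⟨u₀ + (-1 : ℂ) • r, ⟨⟨hw, ?_⟩, ?_⟩, ?_⟩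
  · rw [hw1, ← hre, sub_eq_iff_eq_add.mp hRg]
    module
  · rw [hw2, hu₀h, hr.1.2]
    ring
  · rintro v ⟨⟨hv, hv1⟩, hv2⟩
    obtain ⟨hd, hd1, hd2⟩ := comb (-1) hv hw
    set d : L2R := v + (-1 : ℂ) • (u₀ + (-1 : ℂ) • r) with hddef
    have hdb : d ∈ (extOp φ ψ B).domain := by
      refine ⟨⟨(mem_maxOp_domain φ ψ d).mp hd, ?_⟩, hd⟩
      rw [hd2, hv2, hw2, hu₀h, hr.1.2]
      ring
    have hde : extOp φ ψ B ⟨d, hdb⟩ = maxOp φ ψ ⟨d, hd⟩ := LinearPMap.domRestrict_apply rfl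
    have hd0 := hR2 ⟨d, hdb⟩
    have hz0 : extOp φ ψ B ⟨d, hdb⟩ - z • d = 0 := by
      rw [hde, hd1, hv1, hw1, ← hre, hddef, sub_eq_iff_eq_add.mp hRg]
      module
    rw [hz0, map_zero] at hd0
    have hd0' : v - (u₀ + (-1 : ℂ) • r) = 0 := by
      rw [show v - (u₀ + (-1 : ℂ) • r) = d by rw [hddef]; module]
      exact hd0.symm
    exact sub_eq_zero.mp hd0'

theorem solutionOp_spec {φ ψ : L2R} {B z : ℂ} (hz : z ∈ resolventSet (extOp φ ψ B)) (h : ℂ) :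
    IsSolution φ ψ B z h (solutionOp φ ψ B z h) := by
  have hex := (existsUnique_isSolution hz h).exists
  rw [solutionOp, dif_pos hex]
  exact hex.choose_spec

/-- The defining property `M_B(z) (Γ₁ - B Γ₂) u = Γ₂ u` for `u ∈ ker (Ã* - z)`. -/
theorem mFunction_apply {φ ψ : L2R} {B z : ℂ} (hz : z ∈ resolventSet (extOp φ ψ B)) {u : L2R}
    (hu : ∃ h : u ∈ (maxOp φ ψ).domain, maxOp φ ψ ⟨u, h⟩ = z • u) :
    mFunction φ ψ B z (Gamma1 u - B * Gamma2 u) = Gamma2 u := by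
  rw [mFunction, (existsUnique_isSolution hz _).unique (solutionOp_spec hz _) ⟨hu, rfl⟩]

/-- The detectable subspace: the closure of the linear span of the ranges of
`(A_B - δ)⁻¹ S_{μ,B}` for `δ ∈ ρ(A_B)`, where `μ ∈ ρ(A_B)` is fixed. -/
def detectable (φ ψ : L2R) (B μ : ℂ) : Submodule ℂ L2R :=
  (Submodule.span ℂ {f : L2R | ∃ δ ∈ resolventSet (extOp φ ψ B), ∃ h : ℂ,
    f = resolventOp (extOp φ ψ B) δ (solutionOp φ ψ B μ h)}).topologicalClosure

end Friedrichs

end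

/-! Write `S_z` for the solution operator of the first model applied to `1`, and `A₁`, `A₂` for the
two extensions. No real point lies in either resolvent set: vectors concentrated near a real `t`,
with integral zero and orthogonal to `φ`, are approximate eigenvectors
(`im_ne_zero_of_mem_resolventSet`). Hence the two resolvent sets coincide, and the resolvents agree
at every point of them on the vectors `g = (A₁ - w)⁻¹ S_μ`.

For such `g`, the vector `f = (A₁ - z)⁻¹ g = (A₂ - z)⁻¹ g` lies in both domains. The two boundary
conditions give `(B₁ - B₂) Γ₂ f = 0`, and subtracting the two equations gives `⟨f, φ₁⟩ ψ₁ = ⟨f, φ₂⟩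
ψ₂`. These identities must be carried from `f` to the solutions `S_z`.

The carrier is `apply_solutionOp_eq_of_tendsto`. If a linear `L` vanishes on all `(A₁ - z)⁻¹ (A₁ -
w)⁻¹ S_μ`, then `S_z = S_μ + (z - μ)(A₁ - z)⁻¹ S_μ` and the resolvent identity make `L S_z` affine
in `z`. An affine function with a limit along an imaginary half-axis is constant. The limits come
from solving the model explicitly at `i s`: a solution is determined by the two numbers `⟨u, φ⟩` and
`Γ₂ u`, which satisfy a `2 × 2` linear system with determinant tending to `± π i - B`.

With `L = Γ₂` this forces `B₁ = B₂` (`boundaryParameter_eq`): otherwise `Γ₂ S_z` would be a constant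
equal to both `(π i - B₁)⁻¹` and `(-π i - B₁)⁻¹`. With `L` the difference of the two rank one
perturbations, the limit is `0` because `S_z → 0`, so each `S_z` also solves the second model with
the same trace (`isSolution_of_resolvents_agree`). Equality of the `M`-functions follows. -/

noncomputable section

namespace Friedrichs

/-! ### The Cauchy kernel on the imaginary axis -/

/-- The kernel `x ↦ (x - i s)⁻¹`. -/
def cauchyKernel (s x : ℝ) : ℂ := ((x : ℂ) - s * Complex.I)⁻¹

theorem ofReal_sub_mul_I_ne_zero {s : ℝ} (hs : s ≠ 0) (x : ℝ) : (x : ℂ) - s * Complex.I ≠ 0 := by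
  intro h
  have := congrArg Complex.im h
  simp at this
  exact hs this

theorem norm_cauchyKernel_sq (s x : ℝ) : ‖cauchyKernel s x‖ ^ 2 = (x ^ 2 + s ^ 2)⁻¹ := by
  rw [cauchyKernel, norm_inv, inv_pow, ← Complex.normSq_eq_norm_sq, Complex.normSq_apply]
  simp
  ring

theorem norm_cauchyKernel_le {s : ℝ} (hs : s ≠ 0) (x : ℝ) : ‖cauchyKernel s x‖ ≤ |s|⁻¹ := by
  refine le_of_sq_le_sq ?_ (by positivity)
  rw [norm_cauchyKernel_sq, inv_pow, sq_abs]
  have : 0 < s ^ 2 := by positivity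
  gcongr
  nlinarith [sq_nonneg x]

theorem cauchyKernel_mul {s : ℝ} (hs : s ≠ 0) (x : ℝ) :
    (x : ℂ) * cauchyKernel s x = s * Complex.I * cauchyKernel s x + 1 := by
  have := ofReal_sub_mul_I_ne_zero hs x
  rw [cauchyKernel]
  field_simp
  ring

theorem conj_cauchyKernel (s x : ℝ) : conj (cauchyKernel s x) = cauchyKernel (-s) x := by
  simp [cauchyKernel]

theorem continuous_cauchyKernel {s : ℝ} (hs : s ≠ 0) : Continuous (cauchyKernel s) :=
  (Complex.continuous_ofReal.sub continuous_const).inv₀ (ofReal_sub_mul_I_ne_zero hs)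

theorem inv_sq_add_sq {s : ℝ} (hs : s ≠ 0) (x : ℝ) :
    (x ^ 2 + s ^ 2)⁻¹ = (s ^ 2)⁻¹ * (1 + (x / s) ^ 2)⁻¹ := by
  rw [← mul_inv]
  congr 1
  field_simp
  ring

theorem integrable_norm_cauchyKernel_sq {s : ℝ} (hs : s ≠ 0) :
    Integrable (fun x => ‖cauchyKernel s x‖ ^ 2) := by
  simp only [norm_cauchyKernel_sq, inv_sq_add_sq hs]
  exact (integrable_inv_one_add_sq.comp_div hs).const_mul _

theorem integral_norm_cauchyKernel_sq {s : ℝ} (hs : s ≠ 0) :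
    ∫ x, ‖cauchyKernel s x‖ ^ 2 = |s|⁻¹ * Real.pi := by
  simp only [norm_cauchyKernel_sq, inv_sq_add_sq hs]
  rw [integral_const_mul, Measure.integral_comp_div (fun x : ℝ => (1 + x ^ 2)⁻¹),
    integral_univ_inv_one_add_sq, smul_eq_mul, ← mul_assoc, ← sq_abs]
  have : |s| ≠ 0 := by simpa using hs
  field_simp

theorem memLp_cauchyKernel {s : ℝ} (hs : s ≠ 0) : MemLp (cauchyKernel s) 2 volume := by
  rw [memLp_two_iff_integrable_sq_norm (continuous_cauchyKernel hs).aestronglyMeasurable]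
  exact integrable_norm_cauchyKernel_sq hs

open Classical in
/-- The Cauchy kernel as an element of `L²`; the value at `s = 0` is irrelevant. -/
def cauchyVec (s : ℝ) : L2R :=
  if h : MemLp (cauchyKernel s) 2 volume then h.toLp _ else 0

theorem coeFn_cauchyVec {s : ℝ} (hs : s ≠ 0) : cauchyVec s =ᵐ[volume] cauchyKernel s := by
  rw [cauchyVec, dif_pos (memLp_cauchyKernel hs)]
  exact MemLp.coeFn_toLp _

theorem norm_cauchyVec_sq {s : ℝ} (hs : s ≠ 0) : ‖cauchyVec s‖ ^ 2 = |s|⁻¹ * Real.pi := by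
  rw [← integral_norm_cauchyKernel_sq hs]
  have h := inner_eq_integral (cauchyVec s) (cauchyVec s)
  rw [inner_self_eq_norm_sq_to_K] at h
  have h2 : ∫ x, conj (cauchyVec s x) * cauchyVec s x =
      ((∫ x, ‖cauchyKernel s x‖ ^ 2 : ℝ) : ℂ) := by
    rw [← integral_complex_ofReal]
    refine integral_congr_ae ?_
    filter_upwards [coeFn_cauchyVec hs] with x hx
    rw [hx, mul_comm, Complex.mul_conj']
    simp
  rw [h2] at h
  exact Complex.ofReal_injective (by simpa using h)

theorem memLp_cauchyKernel_mul {s : ℝ} (hs : s ≠ 0) (g : L2R) :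
    MemLp (fun x => cauchyKernel s x * g x) 2 volume := by
  refine (Lp.memLp g).of_le_mul (c := |s|⁻¹)
    ((continuous_cauchyKernel hs).aestronglyMeasurable.mul (Lp.aestronglyMeasurable g))
    (Eventually.of_forall fun x => ?_)
  rw [norm_mul]
  gcongr
  exact norm_cauchyKernel_le hs x

open Classical in
/-- Multiplication by the Cauchy kernel; the value at `s = 0` is irrelevant. -/
def cauchyMul (s : ℝ) : L2R →L[ℂ] L2R :=
  if hs : s ≠ 0 then
    LinearMap.mkContinuous
      { toFun := fun g => (memLp_cauchyKernel_mul hs g).toLp _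
        map_add' := fun f g => by
          rw [← MemLp.toLp_add, MemLp.toLp_eq_toLp_iff]
          filter_upwards [Lp.coeFn_add f g] with x hx
          simp only [Pi.add_apply] at hx ⊢
          rw [hx]; ring
        map_smul' := fun a g => by
          rw [RingHom.id_apply, ← MemLp.toLp_const_smul, MemLp.toLp_eq_toLp_iff]
          filter_upwards [Lp.coeFn_smul a g] with x hx
          simp only [Pi.smul_apply, smul_eq_mul] at hx ⊢
          rw [hx]; ring } |s|⁻¹ fun g => by
      refine Lp.norm_le_mul_norm_of_ae_le_mul ?_
      filter_upwards [(memLp_cauchyKernel_mul hs g).coeFn_toLp] with x hx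
      change ‖(MemLp.toLp _ (memLp_cauchyKernel_mul hs g) : L2R) x‖ ≤ _
      rw [hx, norm_mul]
      gcongr
      exact norm_cauchyKernel_le hs x
  else 0

theorem coeFn_cauchyMul {s : ℝ} (hs : s ≠ 0) (g : L2R) :
    cauchyMul s g =ᵐ[volume] fun x => cauchyKernel s x * g x := by
  rw [cauchyMul, dif_pos hs]
  exact (memLp_cauchyKernel_mul hs g).coeFn_toLp

theorem norm_cauchyMul_le {s : ℝ} (hs : s ≠ 0) (g : L2R) : ‖cauchyMul s g‖ ≤ |s|⁻¹ * ‖g‖ := by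
  refine Lp.norm_le_mul_norm_of_ae_le_mul ?_
  filter_upwards [coeFn_cauchyMul hs g] with x hx
  rw [hx, norm_mul]
  gcongr
  exact norm_cauchyKernel_le hs x

/-- The kernel is not integrable, but averaging it with its reflection leaves `i s / (x² + s²)`,
whose integral over `[-R, R]` is `2 i arctan (R / s)`. The sign of `s` in the limit is what later
distinguishes the two imaginary half-axes. -/
theorem tendsto_integral_cauchyKernel {s : ℝ} (hs : s ≠ 0) :
    Tendsto (fun R : ℝ => ∫ x in (-R)..R, cauchyKernel s x) atTop
      (𝓝 ((Real.sign s * Real.pi : ℝ) * Complex.I)) := by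
  have key : ∀ R : ℝ, ∫ x in (-R)..R, cauchyKernel s x =
      ((2 * Real.arctan (R / s) : ℝ) : ℂ) * Complex.I := by
    intro R
    have h1 : ∫ x in (-R)..R, cauchyKernel s (-x) = ∫ x in (-R)..R, cauchyKernel s x := by simp
    have hc := continuous_cauchyKernel hs
    have hc' : Continuous fun x => cauchyKernel s (-x) := hc.comp continuous_neg
    have h2 : (∫ x in (-R)..R, cauchyKernel s x) + ∫ x in (-R)..R, cauchyKernel s (-x) =
        ∫ x in (-R)..R, ((((2 / s) * (1 + (x / s) ^ 2)⁻¹ : ℝ)) : ℂ) * Complex.I := by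
      rw [← intervalIntegral.integral_add (hc.intervalIntegrable _ _)
        (hc'.intervalIntegrable _ _)]
      refine intervalIntegral.integral_congr fun x _ => ?_
      have e1 := ofReal_sub_mul_I_ne_zero hs x
      have e2 := ofReal_sub_mul_I_ne_zero hs (-x)
      have e4 : (s : ℂ) ≠ 0 := by exact_mod_cast hs
      have e3 : ((s : ℂ) ^ 2 + (x : ℂ) ^ 2) =
          -(((x : ℂ) - s * Complex.I) * (((-x : ℝ) : ℂ) - s * Complex.I)) := by
        push_cast
        linear_combination (s : ℂ) ^ 2 * Complex.I_sq
      have e5 : 2 / (s : ℂ) * (1 + ((x : ℂ) / s) ^ 2)⁻¹ = 2 * s * ((s : ℂ) ^ 2 + (x : ℂ) ^ 2)⁻¹ := by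
        have : (1 + ((x : ℂ) / s) ^ 2) = (s ^ 2 + x ^ 2) / s ^ 2 := by field_simp
        rw [this, inv_div]
        field_simp
      simp only [cauchyKernel]
      push_cast at e2 e3 ⊢
      rw [e5, e3]
      field_simp
      ring
    rw [h1, intervalIntegral.integral_mul_const, intervalIntegral.integral_ofReal,
      intervalIntegral.integral_const_mul,
      intervalIntegral.integral_comp_div (fun x : ℝ => (1 + x ^ 2)⁻¹) hs,
      integral_inv_one_add_sq, neg_div, Real.arctan_neg] at h2
    have e4 : (s : ℂ) ≠ 0 := by exact_mod_cast hs
    have h3 : (2 / s * (s • (Real.arctan (R / s) - -Real.arctan (R / s)))) =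
        2 * (2 * Real.arctan (R / s)) := by
      rw [smul_eq_mul]; field_simp; ring
    rw [h3] at h2
    push_cast at h2 ⊢
    linear_combination h2 / 2
  simp only [key]
  refine (Complex.continuous_ofReal.tendsto _).comp ?_ |>.mul_const _
  rcases lt_or_gt_of_ne hs with h | h
  · have := (Real.tendsto_arctan_atBot.mono_right nhdsWithin_le_nhds).comp
      (tendsto_id.atTop_div_const_of_neg h)
    convert this.const_mul 2 using 1
    congr 1
    rw [Real.sign_of_neg h]; ring_nf
  · have := (Real.tendsto_arctan_atTop.mono_right nhdsWithin_le_nhds).comp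
      (tendsto_id.atTop_div_const h)
    convert this.const_mul 2 using 1
    congr 1
    rw [Real.sign_of_pos h]; ring_nf

/-! ### Solving `(Ã* - i s) u = g` -/

/-- `Γ₁` of the Cauchy kernel `(x - i s)⁻¹`. -/
def cauchyTrace (s : ℝ) : ℂ := (Real.sign s * Real.pi : ℝ) * Complex.I

/-- The function `(w + c) / (x - i s)`. -/
def cauchySol (s : ℝ) (w : L2R) (c : ℂ) : L2R := cauchyMul s w + c • cauchyVec s

theorem coeFn_cauchySol {s : ℝ} (hs : s ≠ 0) (w : L2R) (c : ℂ) :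
    cauchySol s w c =ᵐ[volume] fun x => cauchyKernel s x * (w x + c) := by
  filter_upwards [Lp.coeFn_add (cauchyMul s w) (c • cauchyVec s), coeFn_cauchyMul hs w,
    Lp.coeFn_smul c (cauchyVec s), coeFn_cauchyVec hs] with x h1 h2 h3 h4
  rw [cauchySol, h1, Pi.add_apply, h2, h3, Pi.smul_apply, h4, smul_eq_mul]
  ring

theorem memLp_mul_cauchySol {s : ℝ} (hs : s ≠ 0) (w : L2R) (c : ℂ) :
    MemLp (fun x : ℝ => (x : ℂ) * cauchySol s w c x - c) 2 volume := by
  refine (memLp_congr_ae ?_).mpr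
    (((Lp.memLp (cauchySol s w c)).const_smul (s * Complex.I)).add (Lp.memLp w))
  filter_upwards [coeFn_cauchySol hs w c] with x hx
  simp only [Pi.add_apply, Pi.smul_apply, smul_eq_mul, hx]
  linear_combination (w x + c) * cauchyKernel_mul hs x

theorem cauchySol_mem {s : ℝ} (hs : s ≠ 0) (w : L2R) (c : ℂ) : cauchySol s w c ∈ maxDomain :=
  ⟨c, memLp_mul_cauchySol hs w c⟩

theorem Gamma2_cauchySol {s : ℝ} (hs : s ≠ 0) (w : L2R) (c : ℂ) :
    Gamma2 (cauchySol s w c) = c :=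
  Gamma2_eq (memLp_mul_cauchySol hs w c)

/-- The `w` part is absolutely integrable; the `c` part converges only as a symmetric limit. The
index `-s` appears because the inner product conjugates its first argument, and conjugation
exchanges the kernels at `s` and `-s`. -/
theorem Gamma1_cauchySol {s : ℝ} (hs : s ≠ 0) (w : L2R) (c : ℂ) :
    Gamma1 (cauchySol s w c) = inner ℂ (cauchyVec (-s)) w + c * cauchyTrace s := by
  refine Gamma1_eq ?_
  have hint : Integrable (fun x => cauchyKernel s x * w x) :=
    (memLp_cauchyKernel hs).integrable_mul (Lp.memLp w)
  have hin : inner ℂ (cauchyVec (-s)) w = ∫ x, cauchyKernel s x * w x := by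
    rw [inner_eq_integral]
    refine integral_congr_ae ?_
    filter_upwards [coeFn_cauchyVec (neg_ne_zero.mpr hs)] with x hx
    rw [hx, conj_cauchyKernel, neg_neg]
  rw [hin]
  refine ((intervalIntegral_tendsto_integral hint tendsto_neg_atTop_atBot tendsto_id).add
    ((tendsto_integral_cauchyKernel hs).const_mul c)).congr fun R => ?_
  rw [← intervalIntegral.integral_const_mul, id, ← intervalIntegral.integral_add
    hint.intervalIntegrable (((continuous_cauchyKernel hs).intervalIntegrable _ _).const_mul c)]
  refine intervalIntegral.integral_congr_ae ?_
  filter_upwards [coeFn_cauchySol hs w c] with x hx _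
  rw [hx]
  ring

theorem maxOp_cauchySol (φ ψ : L2R) {s : ℝ} (hs : s ≠ 0) (w : L2R) (c : ℂ)
    (h : cauchySol s w c ∈ (maxOp φ ψ).domain) :
    maxOp φ ψ ⟨cauchySol s w c, h⟩ - (s * Complex.I) • cauchySol s w c =
      w + inner ℂ φ (cauchySol s w c) • ψ := by
  refine Lp.ext ?_
  filter_upwards [maxOp_apply φ ψ ⟨_, h⟩, coeFn_cauchySol hs w c,
    Lp.coeFn_sub (maxOp φ ψ ⟨_, h⟩) ((s * Complex.I) • cauchySol s w c),
    Lp.coeFn_smul (s * Complex.I) (cauchySol s w c),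
    Lp.coeFn_add w (inner ℂ φ (cauchySol s w c) • ψ),
    Lp.coeFn_smul (inner ℂ φ (cauchySol s w c)) ψ] with x h1 h2 h3 h4 h5 h6
  rw [h3, h5, Pi.sub_apply, Pi.add_apply, h1, h4, h6, Pi.smul_apply, Pi.smul_apply, h2,
    Gamma2_cauchySol hs]
  simp only [smul_eq_mul]
  linear_combination (w x + c) * cauchyKernel_mul hs x

/-- Dividing `(Ã* - i s) u = g` by `x - i s` recovers `u` from `g` and the two numbers `⟨u, φ⟩`, `Γ₂
u`, so the equation reduces to two scalar unknowns. -/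
theorem eq_cauchySol (φ ψ : L2R) {s : ℝ} (hs : s ≠ 0) (u : (maxOp φ ψ).domain) :
    (u : L2R) = cauchySol s (maxOp φ ψ u - (s * Complex.I) • (u : L2R) -
      inner ℂ φ (u : L2R) • ψ) (Gamma2 u) := by
  refine Lp.ext ?_
  filter_upwards [maxOp_apply φ ψ u, coeFn_cauchySol hs (maxOp φ ψ u -
      (s * Complex.I) • (u : L2R) - inner ℂ φ (u : L2R) • ψ) (Gamma2 u),
    Lp.coeFn_sub (maxOp φ ψ u - (s * Complex.I) • (u : L2R)) (inner ℂ φ (u : L2R) • ψ),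
    Lp.coeFn_sub (maxOp φ ψ u) ((s * Complex.I) • (u : L2R)),
    Lp.coeFn_smul (s * Complex.I) (u : L2R),
    Lp.coeFn_smul (inner ℂ φ (u : L2R)) ψ] with x h1 h2 h3 h4 h5 h6
  rw [h2, h3, Pi.sub_apply, h4, Pi.sub_apply, h1, h5, h6, Pi.smul_apply, Pi.smul_apply]
  have := ofReal_sub_mul_I_ne_zero hs x
  simp only [smul_eq_mul, cauchyKernel]
  field_simp
  ring

theorem extOp_apply (φ ψ : L2R) (B : ℂ) {u : L2R} (h : u ∈ (extOp φ ψ B).domain) :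
    extOp φ ψ B ⟨u, h⟩ = maxOp φ ψ ⟨u, h.2⟩ :=
  LinearPMap.domRestrict_apply rfl

theorem mem_extOp_domain (φ ψ : L2R) (B : ℂ) {u : L2R} (hu : u ∈ maxDomain)
    (h : Gamma1 u = B * Gamma2 u) : u ∈ (extOp φ ψ B).domain :=
  ⟨⟨hu, sub_eq_zero.mpr h⟩, (mem_maxOp_domain φ ψ u).mpr hu⟩

/-- `1 + ⟨ψ / (x - i s), φ⟩`. -/
def perturbDet (φ ψ : L2R) (s : ℝ) : ℂ := 1 + inner ℂ φ (cauchyMul s ψ)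

/-- The determinant of the `2 × 2` system which decides whether `i s ∈ ρ(A_B)`. -/
def boundaryDet (φ ψ : L2R) (B : ℂ) (s : ℝ) : ℂ :=
  perturbDet φ ψ s * (cauchyTrace s - B) - inner ℂ φ (cauchyVec s) * inner ℂ (cauchyVec (-s)) ψ

/-- The explicit resolvent at `i s`. -/
theorem mem_resolventSet_of_boundaryDet_ne_zero {φ ψ : L2R} {B : ℂ} {s : ℝ} (hs : s ≠ 0)
    (hD : boundaryDet φ ψ B s ≠ 0) :
    (s : ℂ) * Complex.I ∈ resolventSet (extOp φ ψ B) := by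
  set Δ := boundaryDet φ ψ B s with hΔ
  set κ := cauchyTrace s - B with hκ
  set D := perturbDet φ ψ s with hDdef
  set Φ : ℂ := inner ℂ φ (cauchyVec s) with hΦ
  set Ψ : ℂ := inner ℂ (cauchyVec (-s)) ψ with hΨ
  have hΔ' : Δ = D * κ - Φ * Ψ := rfl
  have hD' : D = 1 + inner ℂ φ (cauchyMul s ψ) := rfl
  -- Substituting `u = (g - a ψ + c) / (x - i s)` into `a = ⟨u, φ⟩` and `Γ₁ u = B c` gives `D a - Φ
  -- c = p g` and `-Ψ a + κ c = -q g`. The functionals `a` and `c` below are the Cramer solution.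
  set p : L2R →L[ℂ] ℂ := (innerSL ℂ φ).comp (cauchyMul s) with hp
  set q : L2R →L[ℂ] ℂ := innerSL ℂ (cauchyVec (-s)) with hq
  set c : L2R →L[ℂ] ℂ := Δ⁻¹ • (Ψ • p - D • q) with hc
  set a : L2R →L[ℂ] ℂ := Δ⁻¹ • (κ • p - Φ • q) with ha
  set R : L2R →L[ℂ] L2R := cauchyMul s ∘L (ContinuousLinearMap.id ℂ L2R - a.smulRight ψ) +
    c.smulRight (cauchyVec s) with hR
  have hRg (g : L2R) : R g = cauchySol s (g - a g • ψ) (c g) := rfl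
  have e1 (g : L2R) : inner ℂ φ (R g) = a g := by
    have hap : a g = Δ⁻¹ * (κ * inner ℂ φ (cauchyMul s g) - Φ * inner ℂ (cauchyVec (-s)) g) := rfl
    have hcp : c g = Δ⁻¹ * (Ψ * inner ℂ φ (cauchyMul s g) - D * inner ℂ (cauchyVec (-s)) g) := rfl
    rw [hRg, cauchySol, map_sub, map_smul, inner_add_right, inner_sub_right, inner_smul_right,
      inner_smul_right, ← hΦ, show inner ℂ φ (cauchyMul s ψ) = D - 1 by rw [hD']; ring, hap, hcp]
    field_simp
    rw [hΔ']
    ring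
  have e2 (g : L2R) : Gamma1 (R g) = B * Gamma2 (R g) := by
    have hap : a g = Δ⁻¹ * (κ * inner ℂ φ (cauchyMul s g) - Φ * inner ℂ (cauchyVec (-s)) g) := rfl
    have hcp : c g = Δ⁻¹ * (Ψ * inner ℂ φ (cauchyMul s g) - D * inner ℂ (cauchyVec (-s)) g) := rfl
    rw [hRg, Gamma1_cauchySol hs, Gamma2_cauchySol hs, inner_sub_right, inner_smul_right, ← hΨ,
      show cauchyTrace s = κ + B by rw [hκ]; ring, hap, hcp]
    field_simp
    rw [hΔ']
    ring
  have hmem (g : L2R) : R g ∈ maxDomain := cauchySol_mem hs _ _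
  refine ⟨R, fun g => ⟨mem_extOp_domain φ ψ B (hmem g) (e2 g), ?_⟩, ?_⟩
  · rw [extOp_apply]
    have := maxOp_cauchySol φ ψ hs (g - a g • ψ) (c g) ((mem_maxOp_domain φ ψ _).mpr (hmem g))
    refine this.trans ?_
    rw [← hRg, e1]
    module
  · rintro ⟨f, hf⟩
    rw [extOp_apply]
    have h1 := eq_cauchySol φ ψ hs ⟨f, hf.2⟩
    set g : L2R := maxOp φ ψ ⟨f, hf.2⟩ - ((s : ℂ) * Complex.I) • f with hg
    change R g = f
    simp only at h1
    have h2 : Gamma1 f = B * Gamma2 f := sub_eq_zero.mp hf.1.2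
    set a' : ℂ := inner ℂ φ f with ha'
    set c' : ℂ := Gamma2 f with hc'
    -- Conversely, the two numbers attached to any `f` in the domain satisfy the same system, so
    -- they equal the Cramer solution.
    have h3 : a' = inner ℂ φ (cauchyMul s g) - a' * (D - 1) + c' * Φ := by
      conv_lhs => rw [ha', h1]
      rw [cauchySol, map_sub, map_smul, inner_add_right, inner_sub_right, inner_smul_right,
        inner_smul_right, ← hΦ, show inner ℂ φ (cauchyMul s ψ) = D - 1 by rw [hD']; ring]
    have h4 : B * c' = inner ℂ (cauchyVec (-s)) g - a' * Ψ + c' * (κ + B) := by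
      rw [← h2]
      conv_lhs => rw [h1]
      rw [Gamma1_cauchySol hs, inner_sub_right, inner_smul_right, ← hΨ,
        show cauchyTrace s = κ + B by rw [hκ]; ring]
    have hap : a g = a' := by
      have hap : a g = Δ⁻¹ * (κ * inner ℂ φ (cauchyMul s g) - Φ * inner ℂ (cauchyVec (-s)) g) :=
        rfl
      rw [hap, inv_mul_eq_iff_eq_mul₀ hD, hΔ']
      linear_combination -κ * h3 + Φ * h4
    have hcp : c g = c' := by
      have hcp : c g = Δ⁻¹ * (Ψ * inner ℂ φ (cauchyMul s g) - D * inner ℂ (cauchyVec (-s)) g) :=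
        rfl
      rw [hcp, inv_mul_eq_iff_eq_mul₀ hD, hΔ']
      linear_combination -Ψ * h3 + D * h4
    rw [hRg, hap, hcp]
    exact h1.symm

/-- The linear system satisfied by `⟨u, φ⟩` and `Γ₂ u` for a solution `u` at `i s`. -/
theorem IsSolution.system {φ ψ : L2R} {B : ℂ} {s : ℝ} (hs : s ≠ 0) {u : L2R} {h : ℂ}
    (hu : IsSolution φ ψ B (s * Complex.I) h u) :
    u = cauchySol s (-(inner ℂ φ u • ψ)) (Gamma2 u) ∧
    Gamma2 u * (cauchyTrace s - B) - inner ℂ φ u * inner ℂ (cauchyVec (-s)) ψ = h ∧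
    inner ℂ φ u * perturbDet φ ψ s = Gamma2 u * inner ℂ φ (cauchyVec s) := by
  obtain ⟨⟨hd, h1⟩, h2⟩ := hu
  have h3 := eq_cauchySol φ ψ hs ⟨u, hd⟩
  rw [h1, sub_self, zero_sub] at h3
  refine ⟨h3, ?_, ?_⟩
  · have h4 : Gamma1 u = _ := (congrArg Gamma1 h3).trans (Gamma1_cauchySol hs _ _)
    rw [inner_neg_right, inner_smul_right] at h4
    rw [← h2, h4]
    ring
  · have h4 : inner ℂ φ u = _ := congrArg (fun v => inner ℂ φ v) h3
    rw [cauchySol, map_neg, map_smul, inner_add_right, inner_neg_right, inner_smul_right,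
      inner_smul_right] at h4
    rw [perturbDet]
    linear_combination h4

/-! ### Asymptotics along the imaginary axis -/

theorem tendsto_inv_abs_mul {σ : ℝ} (hσ : σ ≠ 0) :
    Tendsto (fun y : ℝ => |σ * y|⁻¹) atTop (𝓝 0) := by
  simp only [abs_mul]
  exact ((tendsto_abs_atTop_atTop).const_mul_atTop (abs_pos.mpr hσ)).inv_tendsto_atTop

/-- The norm at `s` is `√(π / |s|)`. -/
theorem tendsto_cauchyVec {σ : ℝ} (hσ : σ ≠ 0) :
    Tendsto (fun y : ℝ => cauchyVec (σ * y)) atTop (𝓝 0) := by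
  rw [tendsto_zero_iff_norm_tendsto_zero]
  have h1 : Tendsto (fun y : ℝ => Real.sqrt (|σ * y|⁻¹ * Real.pi)) atTop (𝓝 0) := by
    simpa using ((tendsto_inv_abs_mul hσ).mul_const Real.pi).sqrt
  refine h1.congr' ?_
  filter_upwards [eventually_gt_atTop 0] with y hy
  rw [← norm_cauchyVec_sq (mul_ne_zero hσ hy.ne'), Real.sqrt_sq (norm_nonneg _)]

theorem tendsto_cauchyMul {σ : ℝ} (hσ : σ ≠ 0) (g : L2R) :
    Tendsto (fun y : ℝ => cauchyMul (σ * y) g) atTop (𝓝 0) := by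
  have h1 : Tendsto (fun y : ℝ => |σ * y|⁻¹ * ‖g‖) atTop (𝓝 0) := by
    simpa using (tendsto_inv_abs_mul hσ).mul_const ‖g‖
  refine squeeze_zero_norm' ?_ h1
  filter_upwards [eventually_gt_atTop 0] with y hy
  exact norm_cauchyMul_le (mul_ne_zero hσ hy.ne') g

theorem tendsto_inner_cauchyVec {σ : ℝ} (hσ : σ ≠ 0) (φ : L2R) :
    Tendsto (fun y : ℝ => inner ℂ φ (cauchyVec (σ * y))) atTop (𝓝 0) := by
  simpa using (tendsto_const_nhds (x := φ)).inner (𝕜 := ℂ) (tendsto_cauchyVec hσ)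

theorem tendsto_inner_cauchyVec_neg {σ : ℝ} (hσ : σ ≠ 0) (ψ : L2R) :
    Tendsto (fun y : ℝ => inner ℂ (cauchyVec (-(σ * y))) ψ) atTop (𝓝 0) := by
  simpa using (tendsto_cauchyVec (neg_ne_zero.mpr hσ)).inner (𝕜 := ℂ)
    (tendsto_const_nhds (x := ψ))

theorem tendsto_perturbDet (φ ψ : L2R) {σ : ℝ} (hσ : σ ≠ 0) :
    Tendsto (fun y : ℝ => perturbDet φ ψ (σ * y)) atTop (𝓝 1) := by
  simpa [perturbDet] using
    ((tendsto_const_nhds (x := φ)).inner (𝕜 := ℂ) (tendsto_cauchyMul hσ ψ)).const_add 1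

theorem cauchyTrace_mul {σ y : ℝ} (hy : 0 < y) : cauchyTrace (σ * y) = cauchyTrace σ := by
  rw [cauchyTrace, cauchyTrace]
  rcases lt_trichotomy σ 0 with h | h | h
  · rw [Real.sign_of_neg h, Real.sign_of_neg (mul_neg_of_neg_of_pos h hy)]
  · rw [h, zero_mul]
  · rw [Real.sign_of_pos h, Real.sign_of_pos (mul_pos h hy)]

/-- All terms containing `φ` or `ψ` decay, leaving the determinant of the unperturbed model. It is
nonzero far out on the half-axis unless `B` equals the trace there, one of `± π i`. -/
theorem tendsto_boundaryDet (φ ψ : L2R) (B : ℂ) {σ : ℝ} (hσ : σ ≠ 0) :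
    Tendsto (fun y : ℝ => boundaryDet φ ψ B (σ * y)) atTop (𝓝 (cauchyTrace σ - B)) := by
  have h := ((tendsto_perturbDet φ ψ hσ).mul_const (cauchyTrace σ - B)).sub
    ((tendsto_inner_cauchyVec hσ φ).mul (tendsto_inner_cauchyVec_neg hσ ψ))
  rw [one_mul, mul_zero, sub_zero] at h
  refine h.congr' ?_
  filter_upwards [eventually_gt_atTop 0] with y hy
  rw [boundaryDet, cauchyTrace_mul hy]

theorem eventually_mem_resolventSet (φ ψ : L2R) {B : ℂ} {σ : ℝ} (hσ : σ ≠ 0)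
    (hB : cauchyTrace σ ≠ B) :
    ∀ᶠ y : ℝ in atTop, ((σ * y : ℝ) : ℂ) * Complex.I ∈ resolventSet (extOp φ ψ B) := by
  filter_upwards [eventually_gt_atTop 0,
    (tendsto_boundaryDet φ ψ B hσ).eventually_ne (sub_ne_zero.mpr hB)] with y hy h
  exact mem_resolventSet_of_boundaryDet_ne_zero (mul_ne_zero hσ hy.ne') h

/-- Cramer's rule for `IsSolution.system` with trace `1`. -/
theorem eventually_solution_coeffs (φ ψ : L2R) {B : ℂ} {σ : ℝ} (hσ : σ ≠ 0)
    (hB : cauchyTrace σ ≠ B) :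
    ∀ᶠ y : ℝ in atTop,
      Gamma2 (solutionOp φ ψ B ((σ * y : ℝ) * Complex.I) 1) =
        perturbDet φ ψ (σ * y) / boundaryDet φ ψ B (σ * y) ∧
      inner ℂ φ (solutionOp φ ψ B ((σ * y : ℝ) * Complex.I) 1) =
        inner ℂ φ (cauchyVec (σ * y)) / boundaryDet φ ψ B (σ * y) := by
  filter_upwards [eventually_gt_atTop 0, eventually_mem_resolventSet φ ψ hσ hB,
    (tendsto_boundaryDet φ ψ B hσ).eventually_ne (sub_ne_zero.mpr hB)] with y hy hm h
  obtain ⟨-, h1, h2⟩ := (solutionOp_spec hm 1).system (mul_ne_zero hσ hy.ne')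
  rw [eq_div_iff h, eq_div_iff h, boundaryDet]
  constructor
  · linear_combination perturbDet φ ψ (σ * y) * h1 +
      inner ℂ (cauchyVec (-(σ * y))) ψ * h2
  · linear_combination inner ℂ φ (cauchyVec (σ * y)) * h1 + (cauchyTrace (σ * y) - B) * h2

theorem tendsto_Gamma2_solutionOp (φ ψ : L2R) {B : ℂ} {σ : ℝ} (hσ : σ ≠ 0)
    (hB : cauchyTrace σ ≠ B) :
    Tendsto (fun y : ℝ => Gamma2 (solutionOp φ ψ B ((σ * y : ℝ) * Complex.I) 1)) atTop
      (𝓝 (cauchyTrace σ - B)⁻¹) := by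
  have h := (tendsto_perturbDet φ ψ hσ).div (tendsto_boundaryDet φ ψ B hσ) (sub_ne_zero.mpr hB)
  rw [one_div] at h
  refine h.congr' ?_
  filter_upwards [eventually_solution_coeffs φ ψ hσ hB] with y hy using hy.1.symm

theorem tendsto_solutionOp (φ ψ : L2R) {B : ℂ} {σ : ℝ} (hσ : σ ≠ 0) (hB : cauchyTrace σ ≠ B) :
    Tendsto (fun y : ℝ => solutionOp φ ψ B ((σ * y : ℝ) * Complex.I) 1) atTop (𝓝 0) := by
  have ha : Tendsto (fun y : ℝ => inner ℂ φ (solutionOp φ ψ B ((σ * y : ℝ) * Complex.I) 1)) atTop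
      (𝓝 0) := by
    have h := (tendsto_inner_cauchyVec hσ φ).div (tendsto_boundaryDet φ ψ B hσ)
      (sub_ne_zero.mpr hB)
    rw [zero_div] at h
    refine h.congr' ?_
    filter_upwards [eventually_solution_coeffs φ ψ hσ hB] with y hy using hy.2.symm
  have h := (ha.neg.smul (tendsto_cauchyMul hσ ψ)).add
    ((tendsto_Gamma2_solutionOp φ ψ hσ hB).smul (tendsto_cauchyVec hσ))
  rw [smul_zero, smul_zero, add_zero] at h
  refine h.congr' ?_
  filter_upwards [eventually_gt_atTop 0, eventually_mem_resolventSet φ ψ hσ hB] with y hy hm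
  have h1 := ((solutionOp_spec hm 1).system (mul_ne_zero hσ hy.ne')).1
  rw [cauchySol, ← neg_smul, map_smul] at h1
  exact h1.symm

/-! ### Real points are not in the resolvent set -/

/-- A combination of the indicators of three disjoint subintervals has three free coefficients
against two linear conditions. -/
theorem exists_localized (φ : L2R) (t : ℝ) {ε : ℝ} (hε : 0 < ε) :
    ∃ f : L2R, f ≠ 0 ∧ (∀ᵐ x : ℝ, x ∉ Set.Ioc t (t + ε) → f x = 0) ∧
      ∫ x in Set.Ioc t (t + ε), f x = 0 ∧ inner ℂ φ f = 0 := by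
  set η := ε / 3 with hη
  have hη0 : 0 < η := by positivity
  set I : Fin 3 → Set ℝ := fun k => Set.Ioc (t + k * η) (t + (k + 1) * η) with hI
  have hIm (k) : MeasurableSet (I k) := measurableSet_Ioc
  have hIv (k) : volume (I k) ≠ ⊤ := by simp [hI]
  have hIsub (k) : I k ⊆ Set.Ioc t (t + ε) := by
    have h2 : (k : ℝ) ≤ 2 := by exact_mod_cast Nat.le_of_lt_succ k.2
    refine Set.Ioc_subset_Ioc ?_ ?_
    · have : 0 ≤ (k : ℝ) * η := by positivity
      linarith
    · have : ((k : ℝ) + 1) * η ≤ 3 * η := by gcongr; linarith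
      linarith
  set v : Fin 3 → L2R := fun k => indicatorConstLp 2 (hIm k) (hIv k) (1 : ℂ) with hv
  have hdisj (i j) (hij : i ≠ j) : I i ∩ I j = ∅ := by
    have key (i j : Fin 3) (h : i < j) : I i ∩ I j = ∅ := by
      rw [← Set.disjoint_iff_inter_eq_empty, Set.Ioc_disjoint_Ioc]
      have : (i : ℝ) + 1 ≤ j := by exact_mod_cast h
      refine (min_le_left _ _).trans (le_trans ?_ (le_max_right _ _))
      gcongr
    rcases lt_or_gt_of_ne hij with h | h
    · exact key i j h
    · rw [Set.inter_comm]; exact key j i h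
  have hind : LinearIndependent ℂ v := by
    refine linearIndependent_of_ne_zero_of_inner_eq_zero (𝕜 := ℂ) (fun k h => ?_)
      fun i j hij => ?_
    · have : ‖v k‖ = 0 := by rw [h, norm_zero]
      rw [hv, norm_indicatorConstLp (by norm_num) (by norm_num)] at this
      simp [hI, measureReal_def, add_mul, hη0.le, hη0.ne'] at this
    · simp only [hv]
      rw [L2.inner_indicatorConstLp_indicatorConstLp (hIm i) (hIm j) (hIv i) (hIv j), hdisj i j hij]
      simp
  set χ : L2R := indicatorConstLp 2 (measurableSet_Ioc (a := t) (b := t + ε)) (by simp) (1 : ℂ)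
    with hχ
  obtain ⟨a, ha, ha0⟩ := (Submodule.ne_bot_iff _).mp (LinearMap.ker_ne_bot_of_finrank_lt
    (f := ((innerSL ℂ χ).toLinearMap.prod (innerSL ℂ φ).toLinearMap) ∘ₗ
      Fintype.linearCombination ℂ v) (by simp))
  have ha' := Prod.mk_eq_zero.mp (LinearMap.mem_ker.mp ha)
  refine ⟨Fintype.linearCombination ℂ v a, fun h => ha0 ?_, ?_, ?_, ha'.2⟩
  · rw [Fintype.linearCombination_apply] at h
    exact funext (Fintype.linearIndependent_iff.mp hind a h)
  · have hk (k : Fin 3) : ∀ᵐ x : ℝ, x ∉ Set.Ioc t (t + ε) → v k x = 0 := by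
      filter_upwards [indicatorConstLp_coeFn (p := 2) (hs := hIm k) (hμs := hIv k) (c := (1 : ℂ))]
        with x hx hxn
      rw [hv, hx, Set.indicator_of_notMem fun h => hxn (hIsub k h)]
    rw [Fintype.linearCombination_apply, Fin.sum_univ_three]
    filter_upwards [Lp.coeFn_add (a 0 • v 0 + a 1 • v 1) (a 2 • v 2),
      Lp.coeFn_add (a 0 • v 0) (a 1 • v 1), Lp.coeFn_smul (a 0) (v 0), Lp.coeFn_smul (a 1) (v 1),
      Lp.coeFn_smul (a 2) (v 2), hk 0, hk 1, hk 2] with x h1 h2 h3 h4 h5 h6 h7 h8 hx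
    rw [h1, Pi.add_apply, h2, Pi.add_apply, h3, h4, h5]
    simp [h6 hx, h7 hx, h8 hx]
  · rw [← ha'.1]
    exact (L2.inner_indicatorConstLp_one measurableSet_Ioc _ _).symm

/-- On a localized vector both traces and the rank one term vanish, so `A_B - t` acts as
multiplication by `x - t`, which is at most `ε` on the support. No bounded inverse can exist. -/
theorem im_ne_zero_of_mem_resolventSet {φ ψ : L2R} {B z : ℂ}
    (hz : z ∈ resolventSet (extOp φ ψ B)) : z.im ≠ 0 := by
  intro him
  obtain ⟨R, -, hR⟩ := hz
  set t := z.re with ht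
  have hzt : z = (t : ℂ) := Complex.ext rfl (by simpa using him)
  -- Chosen so that `‖R‖ * ε < 1`.
  set ε : ℝ := (‖R‖ + 1)⁻¹ with hεdef
  have hε : 0 < ε := by positivity
  obtain ⟨f, hf0, hsupp, hint, hφ⟩ := exists_localized φ t hε
  have hx : MemLp (fun x : ℝ => (x : ℂ) * f x) 2 volume := by
    refine (Lp.memLp f).of_le_mul (c := |t| + ε)
      (Complex.continuous_ofReal.aestronglyMeasurable.mul (Lp.aestronglyMeasurable f)) ?_
    filter_upwards [hsupp] with x hx
    by_cases hxm : x ∈ Set.Ioc t (t + ε)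
    · rw [norm_mul, Complex.norm_real, Real.norm_eq_abs]
      gcongr
      rw [abs_le]
      have := neg_abs_le t
      have := le_abs_self t
      constructor <;> linarith [hxm.1, hxm.2]
    · simp [hx hxm]
  have hmem : f ∈ maxDomain := ⟨0, by simpa using hx⟩
  have hG2 : Gamma2 f = 0 := Gamma2_eq (by simpa using hx)
  have hG1 : Gamma1 f = 0 := by
    refine Gamma1_eq (tendsto_const_nhds.congr' ?_)
    filter_upwards [eventually_ge_atTop (|t| + ε)] with r hr
    have := neg_abs_le t
    have := le_abs_self t
    rw [← hint, intervalIntegral.integral_of_le (by linarith [abs_nonneg t])]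
    refine (setIntegral_eq_of_subset_of_ae_sdiff_eq_zero measurableSet_Ioc.nullMeasurableSet
      (Set.Ioc_subset_Ioc (by linarith) (by linarith)) ?_).symm
    filter_upwards [hsupp] with x hx hxm using hx hxm.2
  have hd := mem_extOp_domain φ ψ B hmem (by rw [hG1, hG2, mul_zero])
  have key := hR ⟨f, hd⟩
  rw [extOp_apply] at key
  set w : L2R := maxOp φ ψ ⟨f, hd.2⟩ - z • f with hw
  have hwn : ‖w‖ ≤ ε * ‖f‖ := by
    refine Lp.norm_le_mul_norm_of_ae_le_mul ?_
    filter_upwards [maxOp_apply φ ψ ⟨f, hd.2⟩, Lp.coeFn_sub (maxOp φ ψ ⟨f, hd.2⟩) (z • f),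
      Lp.coeFn_smul z f, hsupp] with x h1 h2 h3 h4
    rw [hw, h2, Pi.sub_apply, h1, h3, Pi.smul_apply, hG2, hφ, smul_eq_mul]
    by_cases hxm : x ∈ Set.Ioc t (t + ε)
    · rw [show (x : ℂ) * f x - 0 + 0 * ψ x - z * f x = ((x - t : ℝ) : ℂ) * f x by
        rw [hzt]; push_cast; ring, norm_mul, Complex.norm_real, Real.norm_eq_abs]
      gcongr
      rw [abs_le]
      constructor <;> linarith [hxm.1, hxm.2]
    · simp [h4 hxm]
  have h1 : ‖f‖ ≤ ‖R‖ * (ε * ‖f‖) := by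
    have h2 := R.le_opNorm w
    have h3 : R w = f := key
    rw [h3] at h2
    exact h2.trans (by gcongr)
  have hf : 0 < ‖f‖ := norm_pos_iff.mpr hf0
  have h2 : ‖R‖ * ε < 1 := by
    rw [hεdef, ← div_eq_mul_inv, div_lt_one (by positivity)]
    linarith
  nlinarith

/-! ### Solutions and resolvents -/

theorem IsSolution.smul {φ ψ : L2R} {B z h : ℂ} {u : L2R} (hu : IsSolution φ ψ B z h u) (a : ℂ) :
    IsSolution φ ψ B z (a * h) (a • u) := by
  obtain ⟨⟨hd, h1⟩, h2⟩ := hu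
  have hm := (mem_maxOp_domain φ ψ u).mp hd
  refine ⟨⟨(maxOp φ ψ).domain.smul_mem a hd, ?_⟩, ?_⟩
  · have := (maxOp φ ψ).map_smul a ⟨u, hd⟩
    rw [h1, smul_comm] at this
    exact this
  · rw [Gamma1_smul a hm, Gamma2_smul a hm, ← h2]
    ring

theorem IsSolution.mem_maxDomain {φ ψ : L2R} {B z h : ℂ} {u : L2R}
    (hu : IsSolution φ ψ B z h u) : u ∈ maxDomain :=
  (mem_maxOp_domain φ ψ u).mp hu.1.1

/-- If the two models have a common solution with trace `1` at `z`, their `M`-functions agree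
at `z`. -/
theorem mFunction_eq_of_isSolution {φ₁ ψ₁ φ₂ ψ₂ : L2R} {B z : ℂ}
    (h₁ : z ∈ resolventSet (extOp φ₁ ψ₁ B)) (h₂ : z ∈ resolventSet (extOp φ₂ ψ₂ B)) {u : L2R}
    (hu₁ : IsSolution φ₁ ψ₁ B z 1 u) (hu₂ : IsSolution φ₂ ψ₂ B z 1 u) :
    mFunction φ₁ ψ₁ B z = mFunction φ₂ ψ₂ B z := by
  ext h
  have e₁ := hu₁.smul h
  have e₂ := hu₂.smul h
  rw [← mul_one h, ← e₁.2, mFunction_apply h₁ e₁.1, mFunction_apply h₂ e₂.1]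

/-- In this form the remainder is a double resolvent with `R` outermost, the shape on which the
functionals below vanish. -/
theorem resolvent_identity {H : Type*} [NormedAddCommGroup H] [NormedSpace ℂ H]
    {T : H →ₗ.[ℂ] H} {z w : ℂ} {R Q : H →L[ℂ] H} (hR : IsResolventAt T z R)
    (hQ : IsResolventAt T w Q) (g : H) : Q g = R g + (w - z) • R (Q g) := by
  obtain ⟨hm, h⟩ := hQ.1 g
  have h1 := hR.2 ⟨Q g, hm⟩
  rw [show T ⟨Q g, hm⟩ - z • Q g = g + (w - z) • Q g by
    rw [sub_eq_iff_eq_add.mp h]; module, map_add, map_smul] at h1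
  exact h1.symm

/-- `S_{z,B} = S_{μ,B} + (z - μ) (A_B - z)⁻¹ S_{μ,B}`. -/
theorem solutionOp_eq_add {φ ψ : L2R} {B z μ : ℂ} (hz : z ∈ resolventSet (extOp φ ψ B))
    (hμ : μ ∈ resolventSet (extOp φ ψ B)) (h : ℂ) :
    solutionOp φ ψ B z h = solutionOp φ ψ B μ h +
      (z - μ) • resolventOp (extOp φ ψ B) z (solutionOp φ ψ B μ h) := by
  refine (existsUnique_isSolution hz h).unique (solutionOp_spec hz h) ?_
  obtain ⟨⟨hd, h1⟩, h2⟩ := solutionOp_spec hμ h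
  obtain ⟨hr, h3⟩ := (resolventOp_spec hz).1 (solutionOp φ ψ B μ h)
  set S := solutionOp φ ψ B μ h
  set r := resolventOp (extOp φ ψ B) z S
  rw [extOp_apply, sub_eq_iff_eq_add] at h3
  have hS := (mem_maxOp_domain φ ψ S).mp hd
  have hrm := hr.1.1
  refine ⟨⟨(maxOp φ ψ).domain.add_mem hd ((maxOp φ ψ).domain.smul_mem _ hr.2), ?_⟩, ?_⟩
  · have e1 := (maxOp φ ψ).map_add ⟨S, hd⟩ ((z - μ) • ⟨r, hr.2⟩)
    rw [LinearPMap.map_smul, h1, h3] at e1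
    refine Eq.trans e1 ?_
    module
  · rw [Gamma1_add hS (maxDomain.smul_mem _ hrm), Gamma2_add hS (maxDomain.smul_mem _ hrm),
      Gamma1_smul _ hrm, Gamma2_smul _ hrm]
    linear_combination h2 + (z - μ) * hr.1.2

theorem resolventOp_mem_maxDomain {φ ψ : L2R} {B z : ℂ} (hz : z ∈ resolventSet (extOp φ ψ B))
    (g : L2R) : resolventOp (extOp φ ψ B) z g ∈ maxDomain :=
  ((resolventOp_spec hz).1 g).choose.1.1

/-! ### Affine dependence on the spectral parameter. -/

theorem tendsto_inv_imaginary_sub {σ : ℝ} (hσ : σ ≠ 0) (μ : ℂ) :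
    Tendsto (fun y : ℝ => (((σ * y : ℝ) : ℂ) * Complex.I - μ)⁻¹) atTop (𝓝 0) := by
  refine tendsto_inv₀_cobounded.comp (tendsto_norm_atTop_iff_cobounded.mp ?_)
  have h1 : Tendsto (fun y : ℝ => |σ * y| - ‖μ‖) atTop atTop := by
    simp only [abs_mul]
    exact tendsto_atTop_add_const_right _ _
      (tendsto_abs_atTop_atTop.const_mul_atTop (abs_pos.mpr hσ))
  refine tendsto_atTop_mono (fun y => ?_) h1
  have := norm_sub_norm_le (((σ * y : ℝ) : ℂ) * Complex.I) μ
  rwa [norm_mul, Complex.norm_I, mul_one, Complex.norm_real, Real.norm_eq_abs] at this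

/-- A linear function on `maxDomain` which vanishes on `(A_B - z)⁻¹ (A_B - w)⁻¹ S_{μ,B}` is constant
on the solutions `S_{z,B}` as soon as it has a limit along an imaginary half-axis. -/
theorem apply_solutionOp_eq_of_tendsto {V : Type*} [NormedAddCommGroup V] [NormedSpace ℂ V]
    {L : L2R → V} (hadd : ∀ f ∈ maxDomain, ∀ g ∈ maxDomain, L (f + g) = L f + L g)
    (hsmul : ∀ (a : ℂ), ∀ f ∈ maxDomain, L (a • f) = a • L f)
    {φ ψ : L2R} {B μ : ℂ} (hμ : μ ∈ resolventSet (extOp φ ψ B))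
    (hL : ∀ z ∈ resolventSet (extOp φ ψ B), ∀ w ∈ resolventSet (extOp φ ψ B),
      L (resolventOp (extOp φ ψ B) z (resolventOp (extOp φ ψ B) w (solutionOp φ ψ B μ 1))) = 0)
    {σ : ℝ} (hσ : σ ≠ 0) (hB : cauchyTrace σ ≠ B) {l : V}
    (hl : Tendsto (fun y : ℝ => L (solutionOp φ ψ B ((σ * y : ℝ) * Complex.I) 1)) atTop (𝓝 l))
    {z : ℂ} (hz : z ∈ resolventSet (extOp φ ψ B)) : L (solutionOp φ ψ B z 1) = l := by
  set S := solutionOp φ ψ B μ 1 with hS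
  have hSm : S ∈ maxDomain := (solutionOp_spec hμ 1).mem_maxDomain
  set v := L (resolventOp (extOp φ ψ B) μ S) with hv
  -- Modulo double resolvents, `(A_B - z)⁻¹ S` may be replaced by `(A_B - μ)⁻¹ S`, so the slope `v`
  -- does not depend on `z`.
  have h1 {z : ℂ} (hz : z ∈ resolventSet (extOp φ ψ B)) :
      L (solutionOp φ ψ B z 1) = L S + (z - μ) • v := by
    have hm := resolventOp_mem_maxDomain hz S
    rw [solutionOp_eq_add hz hμ, ← hS, hadd _ hSm _ (maxDomain.smul_mem _ hm), hsmul _ _ hm, hv,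
      resolvent_identity (resolventOp_spec hz) (resolventOp_spec hμ) S,
      hadd _ hm _ (maxDomain.smul_mem _ (resolventOp_mem_maxDomain hz _)),
      hsmul _ _ (resolventOp_mem_maxDomain hz _), hL z hz μ hμ, smul_zero, add_zero]
  have hev := eventually_mem_resolventSet φ ψ hσ hB
  -- The slope is `(L S_z - L S) / (z - μ)`, a convergent numerator over an unbounded denominator.
  have hv0 : v = 0 := by
    have h2 := (tendsto_inv_imaginary_sub hσ μ).smul (hl.sub_const (L S))
    rw [zero_smul] at h2
    refine tendsto_nhds_unique (tendsto_const_nhds.congr' ?_) h2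
    filter_upwards [hev, eventually_gt_atTop (‖μ‖ / |σ|)] with y hy hy2
    have hne : ((σ * y : ℝ) : ℂ) * Complex.I - μ ≠ 0 := by
      rw [sub_ne_zero]
      rintro rfl
      rw [norm_mul, Complex.norm_I, mul_one, Complex.norm_real, Real.norm_eq_abs, abs_mul,
        mul_div_cancel_left₀ _ (abs_ne_zero.mpr hσ)] at hy2
      exact absurd (le_abs_self y) (not_le.mpr hy2)
    rw [h1 hy, add_sub_cancel_left, inv_smul_smul₀ hne]
  have h3 : l = L S := by
    refine tendsto_nhds_unique hl (tendsto_const_nhds.congr' ?_)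
    filter_upwards [hev] with y hy
    rw [h1 hy, hv0, smul_zero, add_zero]
  rw [h1 hz, hv0, smul_zero, add_zero, h3]

/-! ### Comparison of two models. -/

/-- Maximal operators of different models differ by their rank one perturbations. -/
theorem maxOp_sub_inner_smul (φ₁ ψ₁ φ₂ ψ₂ : L2R) {u : L2R} (h₁ : u ∈ (maxOp φ₁ ψ₁).domain)
    (h₂ : u ∈ (maxOp φ₂ ψ₂).domain) :
    maxOp φ₁ ψ₁ ⟨u, h₁⟩ - inner ℂ φ₁ u • ψ₁ = maxOp φ₂ ψ₂ ⟨u, h₂⟩ - inner ℂ φ₂ u • ψ₂ := by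
  refine Lp.ext ?_
  filter_upwards [maxOp_apply φ₁ ψ₁ ⟨u, h₁⟩, maxOp_apply φ₂ ψ₂ ⟨u, h₂⟩,
    Lp.coeFn_sub (maxOp φ₁ ψ₁ ⟨u, h₁⟩) (inner ℂ φ₁ u • ψ₁),
    Lp.coeFn_sub (maxOp φ₂ ψ₂ ⟨u, h₂⟩) (inner ℂ φ₂ u • ψ₂),
    Lp.coeFn_smul (inner ℂ φ₁ u) ψ₁, Lp.coeFn_smul (inner ℂ φ₂ u) ψ₂] with x e1 e2 e3 e4 e5 e6
  rw [e3, e4, Pi.sub_apply, Pi.sub_apply, e1, e2, e5, e6, Pi.smul_apply, Pi.smul_apply]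
  simp only [smul_eq_mul]
  ring

theorem cauchyTrace_one_ne : cauchyTrace 1 ≠ cauchyTrace (-1) := by
  intro h
  have h := congrArg Complex.im h
  simp [cauchyTrace, Real.sign_one, Real.sign_of_neg] at h
  linarith [Real.pi_pos]

/-- There is a half-axis on which the boundary parameter is not the trace of the Cauchy kernel. -/
theorem exists_cauchyTrace_ne (B : ℂ) : ∃ σ : ℝ, σ ≠ 0 ∧ cauchyTrace σ ≠ B := by
  by_cases h : cauchyTrace 1 = B
  · exact ⟨-1, by norm_num, fun h' => cauchyTrace_one_ne (h.trans h'.symm)⟩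
  · exact ⟨1, one_ne_zero, h⟩

/-- If `Γ₂ S_{z,B}` is constant then `ρ(A_B)` is not cofinal on an imaginary half-axis on which `B`
is the trace of the Cauchy kernel. -/
theorem cauchyTrace_ne_of_Gamma2_const {φ ψ : L2R} {B m : ℂ} {σ : ℝ} (hσ : σ ≠ 0)
    (hmem : ∀ᶠ y : ℝ in atTop, ((σ * y : ℝ) : ℂ) * Complex.I ∈ resolventSet (extOp φ ψ B))
    (hm : ∀ z ∈ resolventSet (extOp φ ψ B), Gamma2 (solutionOp φ ψ B z 1) = m) :
    cauchyTrace σ ≠ B := by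
  intro hB
  have h1 := ((tendsto_inner_cauchyVec hσ φ).mul (tendsto_inner_cauchyVec_neg hσ ψ)).const_mul m
  have h2 := (tendsto_perturbDet φ ψ hσ).add h1
  simp only [mul_zero, add_zero] at h2
  refine zero_ne_one (α := ℂ) (tendsto_nhds_unique (tendsto_const_nhds.congr' ?_) h2)
  filter_upwards [hmem, eventually_gt_atTop 0] with y hy hy0
  obtain ⟨-, e1, e2⟩ := (solutionOp_spec hy 1).system (mul_ne_zero hσ hy0.ne')
  rw [cauchyTrace_mul hy0, hB, sub_self, mul_zero, zero_sub] at e1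
  rw [hm _ hy] at e2
  -- With the coefficient `κ` equal to zero, eliminating `⟨u, φ⟩` leaves `0 = D + m Φ Ψ`, whose
  -- right side tends to `1`.
  linear_combination perturbDet φ ψ (σ * y) * e1 + inner ℂ (cauchyVec (-(σ * y))) ψ * e2

/-- Two models whose resolvents agree on the vectors `(A_B - w)⁻¹ S_{μ,B}`: the boundary parameters
agree. -/
theorem boundaryParameter_eq {φ₁ ψ₁ φ₂ ψ₂ : L2R} {B₁ B₂ μ : ℂ}
    (hμ : μ ∈ resolventSet (extOp φ₁ ψ₁ B₁))
    (hρ : resolventSet (extOp φ₁ ψ₁ B₁) = resolventSet (extOp φ₂ ψ₂ B₂))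
    (hR : ∀ z ∈ resolventSet (extOp φ₁ ψ₁ B₁), ∀ w ∈ resolventSet (extOp φ₁ ψ₁ B₁),
      resolventOp (extOp φ₁ ψ₁ B₁) z (resolventOp (extOp φ₁ ψ₁ B₁) w (solutionOp φ₁ ψ₁ B₁ μ 1)) =
      resolventOp (extOp φ₂ ψ₂ B₂) z (resolventOp (extOp φ₁ ψ₁ B₁) w (solutionOp φ₁ ψ₁ B₁ μ 1))) :
    B₁ = B₂ := by
  by_contra hB
  have hL : ∀ z ∈ resolventSet (extOp φ₁ ψ₁ B₁), ∀ w ∈ resolventSet (extOp φ₁ ψ₁ B₁),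
      Gamma2 (resolventOp (extOp φ₁ ψ₁ B₁) z
        (resolventOp (extOp φ₁ ψ₁ B₁) w (solutionOp φ₁ ψ₁ B₁ μ 1))) = 0 := by
    intro z hz w hw
    have h1 := ((resolventOp_spec hz).1 (resolventOp (extOp φ₁ ψ₁ B₁) w
      (solutionOp φ₁ ψ₁ B₁ μ 1))).choose.1.2
    have hz₂ : z ∈ resolventSet (extOp φ₂ ψ₂ B₂) := hρ ▸ hz
    have h2 := ((resolventOp_spec hz₂).1 (resolventOp (extOp φ₁ ψ₁ B₁) w
      (solutionOp φ₁ ψ₁ B₁ μ 1))).choose.1.2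
    rw [← hR z hz w hw] at h2
    -- The common vector `f` satisfies `Γ₁ f = B₁ Γ₂ f` and `Γ₁ f = B₂ Γ₂ f`.
    refine (mul_eq_zero.mp ?_).resolve_left (sub_ne_zero.mpr hB)
    linear_combination h2 - h1
  have hconst {σ : ℝ} (hσ : σ ≠ 0) (hne : cauchyTrace σ ≠ B₁) :
      ∀ z ∈ resolventSet (extOp φ₁ ψ₁ B₁),
        Gamma2 (solutionOp φ₁ ψ₁ B₁ z 1) = (cauchyTrace σ - B₁)⁻¹ := fun z hz =>
    apply_solutionOp_eq_of_tendsto (fun f hf g hg => Gamma2_add hf hg)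
      (fun a f hf => Gamma2_smul a hf) hμ hL hσ hne (tendsto_Gamma2_solutionOp φ₁ ψ₁ hσ hne) hz
  obtain ⟨σ, hσ, hne⟩ := exists_cauchyTrace_ne B₁
  -- If `B₁` were the trace on this half-axis, `B₂` would not be, so the second model would put the
  -- far part of the half-axis into the common resolvent set. This contradicts the constancy of `Γ₂
  -- S_z`.
  have hall {τ : ℝ} (hτ : τ ≠ 0) : cauchyTrace τ ≠ B₁ := by
    intro h
    refine cauchyTrace_ne_of_Gamma2_const hτ ?_ (hconst hσ hne) h
    rw [hρ]
    exact eventually_mem_resolventSet φ₂ ψ₂ hτ (h ▸ hB)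
  have h1 := hconst one_ne_zero (hall one_ne_zero) μ hμ
  have h2 := hconst (neg_ne_zero.mpr one_ne_zero) (hall (neg_ne_zero.mpr one_ne_zero)) μ hμ
  exact cauchyTrace_one_ne (sub_left_injective (inv_injective (h1.symm.trans h2)))

/-- Under the same hypotheses, the solutions of the first model solve the second one. -/
theorem isSolution_of_resolvents_agree {φ₁ ψ₁ φ₂ ψ₂ : L2R} {B μ : ℂ}
    (hμ : μ ∈ resolventSet (extOp φ₁ ψ₁ B))
    (hρ : resolventSet (extOp φ₁ ψ₁ B) = resolventSet (extOp φ₂ ψ₂ B))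
    (hR : ∀ z ∈ resolventSet (extOp φ₁ ψ₁ B), ∀ w ∈ resolventSet (extOp φ₁ ψ₁ B),
      resolventOp (extOp φ₁ ψ₁ B) z (resolventOp (extOp φ₁ ψ₁ B) w (solutionOp φ₁ ψ₁ B μ 1)) =
      resolventOp (extOp φ₂ ψ₂ B) z (resolventOp (extOp φ₁ ψ₁ B) w (solutionOp φ₁ ψ₁ B μ 1)))
    {z : ℂ} (hz : z ∈ resolventSet (extOp φ₁ ψ₁ B)) :
    IsSolution φ₂ ψ₂ B z 1 (solutionOp φ₁ ψ₁ B z 1) := by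
  -- The difference of the two maximal operators, which is bounded; hence its limit along the
  -- half-axis follows from `S_z → 0`.
  set L : L2R →L[ℂ] L2R := (innerSL ℂ φ₁).smulRight ψ₁ - (innerSL ℂ φ₂).smulRight ψ₂ with hLdef
  have hLa (u : L2R) : L u = inner ℂ φ₁ u • ψ₁ - inner ℂ φ₂ u • ψ₂ := rfl
  have hL : ∀ z ∈ resolventSet (extOp φ₁ ψ₁ B), ∀ w ∈ resolventSet (extOp φ₁ ψ₁ B),
      L (resolventOp (extOp φ₁ ψ₁ B) z
        (resolventOp (extOp φ₁ ψ₁ B) w (solutionOp φ₁ ψ₁ B μ 1))) = 0 := by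
    intro z hz w hw
    set g := resolventOp (extOp φ₁ ψ₁ B) w (solutionOp φ₁ ψ₁ B μ 1) with hg
    obtain ⟨hd₁, e₁⟩ := (resolventOp_spec hz).1 g
    have hz₂ : z ∈ resolventSet (extOp φ₂ ψ₂ B) := hρ ▸ hz
    have h₂ := (resolventOp_spec hz₂).1 g
    rw [← hR z hz w hw] at h₂
    obtain ⟨hd₂, e₂⟩ := h₂
    rw [extOp_apply] at e₁ e₂
    have h := maxOp_sub_inner_smul φ₁ ψ₁ φ₂ ψ₂ hd₁.2 hd₂.2
    rw [sub_eq_iff_eq_add.mp e₁, sub_eq_iff_eq_add.mp e₂] at h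
    rw [hLa, sub_eq_zero]
    exact sub_right_injective h
  obtain ⟨σ, hσ, hne⟩ := exists_cauchyTrace_ne B
  have hlim := (L.continuous.tendsto 0).comp (tendsto_solutionOp φ₁ ψ₁ hσ hne)
  rw [map_zero] at hlim
  have h0 := apply_solutionOp_eq_of_tendsto (L := L) (fun f _ g _ => map_add L f g)
    (fun a f _ => map_smul L a f) hμ hL hσ hne hlim hz
  obtain ⟨⟨hd, h1⟩, h2⟩ := solutionOp_spec hz 1
  have hd₂ := (mem_maxOp_domain φ₂ ψ₂ _).mpr ((mem_maxOp_domain φ₁ ψ₁ _).mp hd)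
  refine ⟨⟨hd₂, ?_⟩, h2⟩
  have h := maxOp_sub_inner_smul φ₁ ψ₁ φ₂ ψ₂ hd hd₂
  rw [hLa, sub_eq_zero] at h0
  rw [h0, h1] at h
  exact (sub_left_injective h).symm

end Friedrichs

end

/-! ### The main theorem. -/

theorem mainTheorem1 (φ₁ ψ₁ φ₂ ψ₂ : Friedrichs.L2R) (B₁ B₂ μ₀ : ℂ)
    (hμ₀ : μ₀ ∈ Friedrichs.resolventSet (Friedrichs.extOp φ₁ ψ₁ B₁))
    (hρ : ∀ z : ℂ, z.im ≠ 0 →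
      (z ∈ Friedrichs.resolventSet (Friedrichs.extOp φ₁ ψ₁ B₁) ↔
        z ∈ Friedrichs.resolventSet (Friedrichs.extOp φ₂ ψ₂ B₂)))
    (hR : ∀ z ∈ Friedrichs.resolventSet (Friedrichs.extOp φ₁ ψ₁ B₁), z.im ≠ 0 →
      ∀ g ∈ Friedrichs.detectable φ₁ ψ₁ B₁ μ₀,
        Friedrichs.resolventOp (Friedrichs.extOp φ₁ ψ₁ B₁) z g =
          Friedrichs.resolventOp (Friedrichs.extOp φ₂ ψ₂ B₂) z g) :
    ∀ z ∈ Friedrichs.resolventSet (Friedrichs.extOp φ₁ ψ₁ B₁),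
      z ∈ Friedrichs.resolventSet (Friedrichs.extOp φ₂ ψ₂ B₂) ∧
        Friedrichs.mFunction φ₁ ψ₁ B₁ z = Friedrichs.mFunction φ₂ ψ₂ B₂ z := by

  have hρ' : Friedrichs.resolventSet (Friedrichs.extOp φ₁ ψ₁ B₁) =
      Friedrichs.resolventSet (Friedrichs.extOp φ₂ ψ₂ B₂) := by
    ext z
    exact ⟨fun h => (hρ z (Friedrichs.im_ne_zero_of_mem_resolventSet h)).mp h,
      fun h => (hρ z (Friedrichs.im_ne_zero_of_mem_resolventSet h)).mpr h⟩
  -- Only the generators `(A_B - w)⁻¹ S_{μ₀,B} 1` of the detectable subspace are needed.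
  have hR' : ∀ z ∈ Friedrichs.resolventSet (Friedrichs.extOp φ₁ ψ₁ B₁),
      ∀ w ∈ Friedrichs.resolventSet (Friedrichs.extOp φ₁ ψ₁ B₁), _ := fun z hz w hw =>
    hR z hz (Friedrichs.im_ne_zero_of_mem_resolventSet hz) _
      (Submodule.le_topologicalClosure _ (Submodule.subset_span ⟨w, hw, 1, rfl⟩))
  obtain rfl := Friedrichs.boundaryParameter_eq hμ₀ hρ' hR'
  exact fun z hz => ⟨hρ' ▸ hz, Friedrichs.mFunction_eq_of_isSolution hz (hρ' ▸ hz)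
    (Friedrichs.solutionOp_spec hz 1) (Friedrichs.isSolution_of_resolvents_agree hμ₀ hρ' hR' hz)⟩
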